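/- Virtual links are oriented, with unordered components, and are identified with Gauss diagrams on $\mu\ge 1$ circles modulo the Reidemeister moves of Gauss diagrams. A triangle of a virtual link diagram is a disk in which one arc passes over both (type $OF$) or under both (type $LF$) of two other arcs that cross each other virtually; the forbidden move at it moves that arc across the virtual crossing. In the Gauss diagram, it exchanges two neighbouring tails ($OF$) or two neighbouring heads ($LF$) of arrows. A virtual link $K$ is $F_n$-similar to a virtual link $L$ if some diagram of $K$ has $n$ nonempty sets $A_1,\dots,A_n$ of triangles, all the triangles of all the sets being pairwise disjoint, such that for every nonempty subfamily of $\{A_1,\dots,A_n\}$ the forbidden moves at all triangles of its members give a diagram of $L$. A virtual knot is $F_n$-trivial if it is $F_n$-similar to the unknot. **Theorem.** Let $L$ be a virtual link and let $n$ be a positive integer. For every positive integer $\ell$ there are an $F_n$-trivial virtual knot $K_n^\ell$ and a virtual link $L_n^\ell$ such that $L_n^\ell$ is a connected sum of $L$ and $K_n^\ell$ and $L_n^\ell$ is $F_n$-similar to $L$. They can be chosen so that $L_n^\ell\neq L_n^{\ell'}$ whenever $\ell\ne\ell'$. -/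

import Mathlib

namespace VirtualLinks

/-- An endpoint of a chord (arrow) of a Gauss diagram: the label of the chord, whether the endpoint
lies on the over path (the tail of the arrow) or on the under path (the head of the arrow), and the
sign of the corresponding real crossing. -/
@[ext]
structure Endpoint where
  chord : ℕ
  isOver : Bool
  sign : ℤˣ
deriving DecidableEq

/-- A Gauss diagram on `μ` oriented circles. `word i` lists the chord endpoints met when going once
around the `i`-th circle, starting from some point of it (`[]` is a circle without endpoints).
Every chord that occurs has exactly one over endpoint and one under endpoint, of equal signs. -/
structure GaussDiagram (μ : ℕ) where
  word : Fin μ → List Endpoint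
  nodup : (((List.ofFn word).flatten).map (fun e => (e.chord, e.isOver))).Nodup
  paired : ∀ i, ∀ e ∈ word i, ∃ j, (⟨e.chord, !e.isOver, e.sign⟩ : Endpoint) ∈ word j

namespace GaussDiagram

variable {μ : ℕ}

/-- `y` is the endpoint that immediately follows `x` on some circle of `D`. -/
def Follows (D : GaussDiagram μ) (x y : Endpoint) : Prop :=
  ∃ (i : Fin μ) (l : List Endpoint), (D.word i).IsRotated (x :: y :: l)

/-- `x` and `y` are neighbours on a circle of `D`: first `x`, then `y` if `s = 1`, and
first `y`, then `x` if `s = -1`. -/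
def FollowsSigned (D : GaussDiagram μ) (s : ℤˣ) (x y : Endpoint) : Prop :=
  (s = 1 ∧ D.Follows x y) ∨ (s = -1 ∧ D.Follows y x)

/-- `D'` is `D` with each endpoint renamed by `f`. If `f` exchanges two neighbouring endpoints
and fixes the others, this transposes them on their circle. -/
def IsMap (f : Endpoint → Endpoint) (D D' : GaussDiagram μ) : Prop :=
  ∀ i, D'.word i = (D.word i).map f

/-- `D'` is `D` with the chords whose labels lie in `S` erased. -/
def IsErase (S : Finset ℕ) (D D' : GaussDiagram μ) : Prop :=
  ∀ i, D'.word i = (D.word i).filter (fun e => e.chord ∉ S)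

/-- The elementary moves of Gauss diagrams. The first three change only the presentation (labels of
the chords, starting points on the circles, numbering of the circles). The others are the
Reidemeister moves; the purely virtual and the mixed Reidemeister moves of virtual link diagrams
do not change the Gauss diagram. -/
inductive Move : GaussDiagram μ → GaussDiagram μ → Prop
  | relabel (D D' : GaussDiagram μ) (f : Equiv.Perm ℕ)
      (h : IsMap (fun e => ⟨f e.chord, e.isOver, e.sign⟩) D D') : Move D D'
  | rotate (D D' : GaussDiagram μ) (h : ∀ i, (D.word i).IsRotated (D'.word i)) : Move D D'
  | reorder (D D' : GaussDiagram μ) (f : Equiv.Perm (Fin μ))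
      (h : ∀ i, D'.word i = D.word (f i)) : Move D D'
  /-- First move: an isolated chord with neighbouring ends is erased. -/
  | r1 (D D' : GaussDiagram μ) (a : ℕ) (s o : ℤˣ)
      (hadj : D.FollowsSigned o ⟨a, true, s⟩ ⟨a, false, s⟩)
      (h : IsErase {a} D D') : Move D D'
  /-- Second move: two chords of opposite signs, with neighbouring tails and neighbouring heads,
  are erased. -/
  | r2 (D D' : GaussDiagram μ) (a b : ℕ) (s p q : ℤˣ) (hab : a ≠ b)
      (hover : D.FollowsSigned p ⟨a, true, s⟩ ⟨b, true, -s⟩)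
      (hunder : D.FollowsSigned q ⟨a, false, s⟩ ⟨b, false, -s⟩)
      (h : IsErase {a, b} D D') : Move D D'
  /-- Third move: a top strand crosses over a middle strand at `a` and over a bottom strand at `b`,
  and the middle strand crosses over the bottom strand at `c`. The units `p`, `q`, `r` record the
  orders in which the three strands meet these crossings; the signs of the crossings are as they
  are for three oriented arcs that bound a triangle in the plane, of either one of its two
  cyclic orders (`t`). On each strand the two endpoints are exchanged. -/
  | r3 (D D' : GaussDiagram μ) (a b c : ℕ) (p q r t : ℤˣ)
      (hab : a ≠ b) (hac : a ≠ c) (hbc : b ≠ c)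
      (htop : D.FollowsSigned p ⟨a, true, t * p * q⟩ ⟨b, true, t * p * r⟩)
      (hmid : D.FollowsSigned q ⟨a, false, t * p * q⟩ ⟨c, true, t * q * r⟩)
      (hbot : D.FollowsSigned r ⟨b, false, t * p * r⟩ ⟨c, false, t * q * r⟩)
      (h : IsMap
        (Equiv.swap ⟨a, true, t * p * q⟩ ⟨b, true, t * p * r⟩ ∘
          Equiv.swap ⟨a, false, t * p * q⟩ ⟨c, true, t * q * r⟩ ∘
          Equiv.swap ⟨b, false, t * p * r⟩ ⟨c, false, t * q * r⟩) D D') : Move D D'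

/-- A triangle of `D`, written as the ordered pair of its neighbouring endpoints: two neighbouring
tails (one arc passes over two other arcs, type `OF`) or two neighbouring heads (one arc passes
under two other arcs, type `LF`). -/
def IsTriangle (D : GaussDiagram μ) (d : Endpoint × Endpoint) : Prop :=
  D.Follows d.1 d.2 ∧ d.1.isOver = d.2.isOver

/-- Two triangles are disjoint: they have no real crossing in common. -/
def TrianglesDisjoint (d e : Endpoint × Endpoint) : Prop :=
  d.1.chord ≠ e.1.chord ∧ d.1.chord ≠ e.2.chord ∧ d.2.chord ≠ e.1.chord ∧ d.2.chord ≠ e.2.chord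

/-- `D'` is obtained from `D` by the forbidden moves at all the triangles in `S`: in each of them
the two neighbouring endpoints are exchanged, and all other endpoints stay. -/
def IsForbiddenMove (S : Set (Endpoint × Endpoint)) (D D' : GaussDiagram μ) : Prop :=
  ∃ f : Endpoint → Endpoint,
    (∀ d ∈ S, f d.1 = d.2 ∧ f d.2 = d.1) ∧
    (∀ e, (∀ d ∈ S, e ≠ d.1 ∧ e ≠ d.2) → f e = e) ∧
    IsMap f D D'

/-- The Gauss diagram of the knot diagram without double points. -/
def trivialKnot : GaussDiagram 1 where
  word _ := []
  nodup := by simp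
  paired := by simp

end GaussDiagram

/-- Oriented virtual links with `μ` (unordered) components: Gauss diagrams up to the equivalence
relation generated by the moves. -/
def VirtualLink (μ : ℕ) : Type := Quot (GaussDiagram.Move (μ := μ))

/-- Virtual knots. -/
abbrev VirtualKnot : Type := VirtualLink 1

variable {μ : ℕ}

/-- The virtual link of a diagram. -/
def GaussDiagram.link (D : GaussDiagram μ) : VirtualLink μ := Quot.mk _ D

/-- The unknot. -/
def unknot : VirtualKnot := GaussDiagram.trivialKnot.link

/-- `K` is `F_n`-similar to `L`: some diagram of `K` has `n` nonempty families `A i` of triangles,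
all the triangles of all the families being pairwise disjoint, such that the forbidden moves at all
triangles of the families in any nonempty subfamily give a diagram of `L`. -/
def FSimilar (n : ℕ) (K L : VirtualLink μ) : Prop :=
  ∃ (D : GaussDiagram μ) (A : Fin n → Set (Endpoint × Endpoint)),
    D.link = K ∧
    (∀ i, (A i).Nonempty) ∧
    (∀ i, ∀ d ∈ A i, D.IsTriangle d) ∧
    (∀ i j, ∀ d ∈ A i, ∀ e ∈ A j, (i, d) ≠ (j, e) → GaussDiagram.TrianglesDisjoint d e) ∧
    ∀ T : Set (Fin n), T.Nonempty →
      ∃ D' : GaussDiagram μ,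
        GaussDiagram.IsForbiddenMove (⋃ i ∈ T, A i) D D' ∧ D'.link = L

/-- A virtual knot is `F_n`-trivial if it is `F_n`-similar to the unknot. -/
def FTrivial (n : ℕ) (K : VirtualKnot) : Prop := FSimilar n K unknot

/-- `M` is a connected sum of the virtual link `L` and the virtual knot `K`: for some diagrams of
`L` and `K` (with distinct labels), the circle of `K`, cut open, is spliced into one of the circles
of `L`. As starting points of words are arbitrary, this covers all choices of the cut points. -/
def IsConnectedSum (L : VirtualLink μ) (K : VirtualKnot) (M : VirtualLink μ) : Prop :=
  ∃ (D : GaussDiagram μ) (E : GaussDiagram 1) (F : GaussDiagram μ) (i : Fin μ),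
    D.link = L ∧ E.link = K ∧ F.link = M ∧
    F.word i = D.word i ++ E.word 0 ∧ ∀ j, j ≠ i → F.word j = D.word j

end VirtualLinks

/-! Construction. New arcs are added at the end of a circle; each carries tails of arrows and then a
block of heads. An arrow is a signed generator (block, letter), naming the arcs of its head and its
tail, and one list of arrows fixes the order of all heads and all tails at once. Consecutive arrows
with equal generators and opposite signs disappear by a second Reidemeister move, so a list whose
value in the free group on pairs (block, letter) is 1 can be removed altogether
(`splice_link_of_value_eq_one`).

A gadget is a commutator x y x⁻¹ y⁻¹ in one block. The forbidden move at its first two heads gives y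
x x⁻¹ y⁻¹, which cancels. Every block is filled with an iterated commutator of gadgets with indices
0, …, n - 1, and making all gadgets of a single index trivial already kills it. The triangles of the
gadgets of index k form the k-th family, which gives the similarity to the original link, and to the
unknot when the original diagram is trivial (`fSimilar_splice`, `gadgetWord_value_eq_one`).

Distinctness. The invariant is the number of colourings by the symmetric group on five points, in
effect of homomorphisms from the group of the virtual link. Iterated commutators must remain visible
at every depth, so a group with a perfect subgroup is needed: there are five 5-cycles, each a
commutator of two of the five, such that the k-th is conjugated to the (k+1)-st by another of them
(`color_commutator`, `color_conj`). Colouring arc j of a copy by `color j`, its block acts as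
conjugation by `color (conjugator j)` and leads to the colour of arc j + 1; after five arcs the
colouring closes up (`chain_copy`). Each further copy keeps all earlier colourings, extended
constantly, and adds a nonconstant one, so the number grows strictly with the number of copies
(`coloringNumber_strictMono`). -/

namespace VirtualLinks

/-! ### Transport of states along words and its closed orbits. -/

section Chain

variable {X : Type*}

/-- Transport along a word: each endpoint relates the state before it to the state after it. -/
def Chain (σ : Endpoint → X → X → Prop) : X → List Endpoint → X → Prop
  | g, [], h => g = h
  | g, e :: l, h => ∃ m, σ e g m ∧ Chain σ m l h

@[simp] theorem chain_nil (σ : Endpoint → X → X → Prop) (g h : X) :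
    Chain σ g [] h ↔ g = h := Iff.rfl

@[simp] theorem chain_cons (σ : Endpoint → X → X → Prop) (g h : X) (e : Endpoint)
    (l : List Endpoint) : Chain σ g (e :: l) h ↔ ∃ m, σ e g m ∧ Chain σ m l h := Iff.rfl

theorem chain_append (σ : Endpoint → X → X → Prop) (g h : X) (u v : List Endpoint) :
    Chain σ g (u ++ v) h ↔ ∃ m, Chain σ g u m ∧ Chain σ m v h := by
  induction u generalizing g with
  | nil => simp
  | cons e u ih =>
    simp only [List.cons_append, chain_cons, ih]
    constructor
    · rintro ⟨m, hm, k, hk, hk'⟩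
      exact ⟨k, ⟨m, hm, hk⟩, hk'⟩
    · rintro ⟨k, ⟨m, hm, hk⟩, hk'⟩
      exact ⟨m, hm, k, hk, hk'⟩

theorem chain_congr {σ σ' : Endpoint → X → X → Prop} {l : List Endpoint}
    (hl : ∀ e ∈ l, σ e = σ' e) (g h : X) : Chain σ g l h ↔ Chain σ' g l h := by
  induction l generalizing g with
  | nil => simp
  | cons e u ih =>
    simp only [chain_cons, hl e (by simp), ih (fun e he => hl e (by simp [he]))]

theorem chain_map (σ : Endpoint → X → X → Prop) (f : Endpoint → Endpoint) (l : List Endpoint)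
    (g h : X) : Chain σ g (l.map f) h ↔ Chain (fun e => σ (f e)) g l h := by
  induction l generalizing g with
  | nil => simp
  | cons e u ih => simp only [List.map_cons, chain_cons, ih]

/-- Each endpoint acts by a partial bijection. -/
def PartialBij (σ : Endpoint → X → X → Prop) : Prop :=
  ∀ e, (∀ g h h', σ e g h → σ e g h' → h = h') ∧ (∀ g g' h, σ e g h → σ e g' h → g = g')

theorem PartialBij.chain_right {σ : Endpoint → X → X → Prop} (hσ : PartialBij σ)
    {l : List Endpoint} {g h h' : X} (h1 : Chain σ g l h) (h2 : Chain σ g l h') : h = h' := by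
  induction l generalizing g with
  | nil => exact (h1 : g = h).symm.trans h2
  | cons e u ih =>
    obtain ⟨m, hm, hc⟩ := h1
    obtain ⟨m', hm', hc'⟩ := h2
    obtain rfl := (hσ e).1 _ _ _ hm hm'
    exact ih hc hc'

theorem PartialBij.chain_left {σ : Endpoint → X → X → Prop} (hσ : PartialBij σ)
    {l : List Endpoint} {g g' h : X} (h1 : Chain σ g l h) (h2 : Chain σ g' l h) : g = g' := by
  induction l generalizing g g' with
  | nil => exact (h1 : g = h).trans (h2 : g' = h).symm
  | cons e u ih =>
    obtain ⟨m, hm, hc⟩ := h1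
    obtain ⟨m', hm', hc'⟩ := h2
    obtain rfl := ih hc hc'
    exact (hσ e).2 _ _ _ hm hm'

/-- The states that return to themselves along a word. -/
abbrev ClosedState (σ : Endpoint → X → X → Prop) (w : List Endpoint) : Type _ :=
  {g : X // Chain σ g w g}

/-- Moving the base point past `u` carries a closed state to the state reached after `u`. Partial
bijectivity makes this state unique, and recoverable in both directions. -/
theorem closedState_append_comm {σ : Endpoint → X → X → Prop} (hσ : PartialBij σ)
    (u v : List Endpoint) : Nonempty (ClosedState σ (u ++ v) ≃ ClosedState σ (v ++ u)) := by
  -- Both sides are compared with the pairs of states at the two cut points.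
  let Y : Type _ := {p : X × X // Chain σ p.1 u p.2 ∧ Chain σ p.2 v p.1}
  let F : Y → ClosedState σ (u ++ v) :=
    fun p => ⟨p.1.1, (chain_append _ _ _ _ _).2 ⟨p.1.2, p.2⟩⟩
  let F' : Y → ClosedState σ (v ++ u) :=
    fun p => ⟨p.1.2, (chain_append _ _ _ _ _).2 ⟨p.1.1, p.2.symm⟩⟩
  have hF : Function.Bijective F := by
    constructor
    · rintro ⟨⟨a, b⟩, h1, h2⟩ ⟨⟨a', b'⟩, h1', h2'⟩ h
      obtain rfl : a = a' := congrArg Subtype.val h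
      obtain rfl : b = b' := hσ.chain_right h1 h1'
      rfl
    · rintro ⟨g, hg⟩
      obtain ⟨m, hm⟩ := (chain_append _ _ _ _ _).1 hg
      exact ⟨⟨(g, m), hm⟩, rfl⟩
  have hF' : Function.Bijective F' := by
    constructor
    · rintro ⟨⟨a, b⟩, h1, h2⟩ ⟨⟨a', b'⟩, h1', h2'⟩ h
      obtain rfl : b = b' := congrArg Subtype.val h
      obtain rfl : a = a' := hσ.chain_left h1 h1'
      rfl
    · rintro ⟨g, hg⟩
      obtain ⟨m, hm⟩ := (chain_append _ _ _ _ _).1 hg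
      exact ⟨⟨(m, g), hm.symm⟩, rfl⟩
  exact ⟨(Equiv.ofBijective F hF).symm.trans (Equiv.ofBijective F' hF')⟩

theorem closedState_rotate {σ : Endpoint → X → X → Prop} (hσ : PartialBij σ)
    {w w' : List Endpoint} (h : w.IsRotated w') :
    Nonempty (ClosedState σ w ≃ ClosedState σ w') := by
  obtain ⟨n, hn, rfl⟩ := List.isRotated_iff_mod.1 h
  rw [List.rotate_eq_drop_append_take hn]
  have := closedState_append_comm hσ (w.take n) (w.drop n)
  rwa [List.take_append_drop] at this

/-- The form in which Reidemeister moves are used: only the transport through the changed piece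
matters. The relation attached to an endpoint may change too, as long as it is unchanged on the rest
`l`. -/
theorem closedState_local {σ σ' : Endpoint → X → X → Prop} (hσ : PartialBij σ)
    (hσ' : PartialBij σ') {w w' u u' l : List Endpoint} (hw : w.IsRotated (u ++ l))
    (hw' : w'.IsRotated (u' ++ l)) (hu : ∀ g h, Chain σ g u h ↔ Chain σ' g u' h)
    (hl : ∀ e ∈ l, σ e = σ' e) : Nonempty (ClosedState σ w ≃ ClosedState σ' w') := by
  obtain ⟨e1⟩ := closedState_rotate hσ hw
  obtain ⟨e2⟩ := closedState_rotate hσ' hw'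
  refine ⟨(e1.trans (Equiv.subtypeEquivRight fun g => ?_)).trans e2.symm⟩
  simp only [chain_append, hu, chain_congr hl]

theorem closedState_congr {σ σ' : Endpoint → X → X → Prop} {w : List Endpoint}
    (hl : ∀ e ∈ w, σ e = σ' e) : Nonempty (ClosedState σ w ≃ ClosedState σ' w) :=
  ⟨Equiv.subtypeEquivRight fun _ => chain_congr hl _ _⟩

end Chain

/-! ### Exchanging two neighbouring endpoints. -/

section Words

variable {μ : ℕ}

/-- No endpoint is met twice on the circles. -/
def Separated (w : Fin μ → List Endpoint) : Prop :=
  (∀ i, (w i).Nodup) ∧ ∀ i j e, e ∈ w i → e ∈ w j → i = j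

theorem Separated.map {w : Fin μ → List Endpoint} (hw : Separated w) (f : Equiv.Perm Endpoint) :
    Separated fun i => (w i).map f := by
  refine ⟨fun i => (hw.1 i).map f.injective, fun i j e hi hj => ?_⟩
  simp only [List.mem_map] at hi hj
  obtain ⟨a, ha, rfl⟩ := hi
  obtain ⟨b, hb, hab⟩ := hj
  obtain rfl := f.injective hab
  exact hw.2 i j _ ha hb

theorem map_eq_self {f : Endpoint → Endpoint} {l : List Endpoint} (h : ∀ e ∈ l, f e = e) :
    l.map f = l := by
  conv_rhs => rw [← List.map_id l]
  exact List.map_congr_left h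

/-- Since no endpoint is met twice, the transposition acts on one circle only and there only on the
neighbouring pair; the other circles are handled by the agreement of the two transports. -/
theorem closedState_swap {X : Type*} {σ σ' : Endpoint → X → X → Prop} (hσ : PartialBij σ)
    (hσ' : PartialBij σ') {w : Fin μ → List Endpoint} (hw : Separated w) {i : Fin μ}
    {x y : Endpoint} {l : List Endpoint} (hxy : (w i).IsRotated (x :: y :: l))
    (hcomm : ∀ g h, Chain σ g [x, y] h ↔ Chain σ' g [y, x] h)
    (hother : ∀ j, ∀ e ∈ w j, e ≠ x → e ≠ y → σ e = σ' e) (j : Fin μ) :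
    Nonempty (ClosedState σ (w j) ≃ ClosedState σ' ((w j).map (Equiv.swap x y))) := by
  have hx : x ∈ w i := hxy.mem_iff.2 (by simp)
  have hy : y ∈ w i := hxy.mem_iff.2 (by simp)
  by_cases hj : j = i
  · subst hj
    have hnd : (x :: y :: l).Nodup := hxy.nodup_iff.1 (hw.1 j)
    simp only [List.nodup_cons, List.mem_cons, not_or] at hnd
    have hl : ∀ e ∈ l, e ≠ x ∧ e ≠ y := fun e he =>
      ⟨fun h => hnd.1.2 (h ▸ he), fun h => hnd.2.1 (h ▸ he)⟩
    have hmap : ((w j).map (Equiv.swap x y)).IsRotated ([y, x] ++ l) := by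
      have := hxy.map (Equiv.swap x y)
      rwa [List.map_cons, List.map_cons, Equiv.swap_apply_left, Equiv.swap_apply_right,
        map_eq_self fun e he => Equiv.swap_apply_of_ne_of_ne (hl e he).1 (hl e he).2] at this
    exact closedState_local hσ hσ' (u := [x, y]) hxy hmap hcomm fun e he =>
      hother j e (hxy.mem_iff.2 (by simp [he])) (hl e he).1 (hl e he).2
  · have hne : ∀ e ∈ w j, e ≠ x ∧ e ≠ y := fun e he =>
      ⟨fun h => hj (hw.2 _ _ e he (h ▸ hx)), fun h => hj (hw.2 _ _ e he (h ▸ hy))⟩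
    rw [map_eq_self fun e he => Equiv.swap_apply_of_ne_of_ne (hne e he).1 (hne e he).2]
    exact closedState_congr fun e he => hother j e he (hne e he).1 (hne e he).2

end Words

/-! ### Colourings of Gauss diagrams by a group. -/

section Coloring

variable {G : Type*} [Group G] {μ : ℕ}

/-- The change of colour at an endpoint: an over endpoint has the colour of its chord, and an under
endpoint conjugates by the colour of its chord. -/
def crossing (c : ℕ → G) (e : Endpoint) (g h : G) : Prop :=
  if e.isOver then c e.chord = g ∧ h = g
  else h = (c e.chord ^ (e.sign : ℤ))⁻¹ * g * c e.chord ^ (e.sign : ℤ)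

@[simp] theorem crossing_over (c : ℕ → G) (a : ℕ) (s : ℤˣ) (g h : G) :
    crossing c ⟨a, true, s⟩ g h ↔ c a = g ∧ h = g := by simp [crossing]

@[simp] theorem crossing_under (c : ℕ → G) (a : ℕ) (s : ℤˣ) (g h : G) :
    crossing c ⟨a, false, s⟩ g h ↔ h = (c a ^ (s : ℤ))⁻¹ * g * c a ^ (s : ℤ) := by
  simp [crossing]

theorem crossing_congr {c c' : ℕ → G} {e : Endpoint} (h : c e.chord = c' e.chord) :
    crossing c e = crossing c' e := by
  ext g k
  simp [crossing, h]

theorem partialBij_crossing (c : ℕ → G) : PartialBij (crossing c) := by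
  rintro ⟨a, o, s⟩
  cases o
  · simp only [crossing_under]
    constructor
    · rintro g h h' rfl rfl
      rfl
    · rintro g g' h rfl h2
      simpa using h2
  · simp only [crossing_over]
    constructor
    · rintro g h h' ⟨-, rfl⟩ ⟨-, rfl⟩
      rfl
    · rintro g g' h ⟨-, rfl⟩ ⟨-, rfl⟩
      rfl

/-- The chord `a` has an endpoint in the word family `w`. -/
def Occurs (w : Fin μ → List Endpoint) (a : ℕ) : Prop := ∃ i, ∃ e ∈ w i, e.chord = a

/-- Colour vectors of the chords, normalised outside of the diagram. -/
abbrev ChordColoring (G : Type*) [Group G] (w : Fin μ → List Endpoint) : Type _ :=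
  {c : ℕ → G // ∀ a, ¬ Occurs w a → c a = 1}

/-- The colourings of a word family: a colour for each chord and a colour for each base point. -/
def Coloring (G : Type*) [Group G] (w : Fin μ → List Endpoint) : Type _ :=
  {p : (ℕ → G) × (Fin μ → G) // (∀ a, ¬ Occurs w a → p.1 a = 1) ∧
    ∀ i, Chain (crossing p.1) (p.2 i) (w i) (p.2 i)}

/-- A colouring consists of chord colours and closed states for all circles. -/
def coloringEquivSigma (w : Fin μ → List Endpoint) :
    Coloring G w ≃ Σ c : ChordColoring G w, ∀ i, ClosedState (crossing c.1) (w i) where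
  toFun p := ⟨⟨p.1.1, p.2.1⟩, fun i => ⟨p.1.2 i, p.2.2 i⟩⟩
  invFun q := ⟨(q.1.1, fun i => (q.2 i).1), q.1.2, fun i => (q.2 i).2⟩
  left_inv _ := rfl
  right_inv _ := rfl

/-- Base point colours are compared separately for each vector of chord colours. This allows
arguments by cases on the chord colours, including the case in which both fibres are empty. -/
theorem coloring_fiberwise {w w' : Fin μ → List Endpoint} (e : (ℕ → G) ≃ (ℕ → G))
    (hsupp : ∀ c, (∀ a, ¬ Occurs w a → c a = 1) ↔ ∀ a, ¬ Occurs w' a → e c a = 1)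
    (hfib : ∀ c : ℕ → G, Nonempty ((∀ i, ClosedState (crossing c) (w i)) ≃
      ∀ i, ClosedState (crossing (e c)) (w' i))) :
    Nonempty (Coloring G w ≃ Coloring G w') := by
  let E : ChordColoring G w ≃ ChordColoring G w' := e.subtypeEquiv hsupp
  exact ⟨((coloringEquivSigma w).trans (Equiv.sigmaCongr E fun c => (hfib c.1).some)).trans
    (coloringEquivSigma w').symm⟩

theorem nonempty_pi_equiv {A B : Fin μ → Type*} (h : ∀ i, Nonempty (A i ≃ B i)) :
    Nonempty ((∀ i, A i) ≃ ∀ i, B i) :=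
  ⟨Equiv.piCongrRight fun i => (h i).some⟩

theorem coloring_rotate {w w' : Fin μ → List Endpoint} (h : ∀ i, (w i).IsRotated (w' i)) :
    Nonempty (Coloring G w ≃ Coloring G w') := by
  refine coloring_fiberwise (Equiv.refl _) (fun c => ?_) fun c =>
    nonempty_pi_equiv fun i => closedState_rotate (partialBij_crossing c) (h i)
  have : ∀ a, Occurs w a ↔ Occurs w' a := fun a => by simp [Occurs, (h _).mem_iff]
  simp [this]

theorem chain_update {c : ℕ → G} {a : ℕ} {u : G} {l : List Endpoint}
    (hl : ∀ e ∈ l, e.chord ≠ a) (g h : G) :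
    Chain (crossing (Function.update c a u)) g l h ↔ Chain (crossing c) g l h :=
  chain_congr (fun e he => crossing_congr (by simp [hl e he])) g h

/-- A tail without its head imposes nothing: at the start of the circle it only records the base
point colour as the colour of `a`. Without it, the normalisation forces that colour to be 1. -/
theorem coloring_orphan (w : Fin μ → List Endpoint) (i : Fin μ) (a : ℕ) (s : ℤˣ)
    (l : List Endpoint) (hl : ∀ e ∈ l, e.chord ≠ a)
    (ha : ∀ j, j ≠ i → ∀ e ∈ w j, e.chord ≠ a) :
    Nonempty (Coloring G (Function.update w i (⟨a, true, s⟩ :: l)) ≃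
      Coloring G (Function.update w i l)) := by
  have hoff : ∀ j, ∀ e ∈ Function.update w i l j, e.chord ≠ a := by
    intro j e he
    by_cases hj : j = i
    · subst hj
      exact hl e (by simpa using he)
    · exact ha j hj e (by simpa [hj] using he)
  have hocc : ∀ b, Occurs (Function.update w i (⟨a, true, s⟩ :: l)) b ↔
      b = a ∨ Occurs (Function.update w i l) b := by
    intro b
    constructor
    · rintro ⟨j, e, he, rfl⟩
      by_cases hj : j = i
      · subst hj
        simp only [Function.update_self, List.mem_cons] at he
        rcases he with rfl | he
        · exact Or.inl rfl
        · exact Or.inr ⟨j, e, by simpa using he, rfl⟩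
      · exact Or.inr ⟨j, e, by simpa [hj] using he, rfl⟩
    · rintro (rfl | ⟨j, e, he, rfl⟩)
      · exact ⟨i, ⟨b, true, s⟩, by simp, rfl⟩
      · by_cases hj : j = i
        · subst hj
          exact ⟨j, e, by simp at he; simp [he], rfl⟩
        · exact ⟨j, e, by simpa [hj] using he, rfl⟩
  have hna : ¬ Occurs (Function.update w i l) a := by
    rintro ⟨j, e, he, h⟩
    exact hoff j e he h
  refine ⟨⟨fun p => ⟨(Function.update p.1.1 a 1, p.1.2), fun b hb => ?_, fun j => ?_⟩,
    fun p => ⟨(Function.update p.1.1 a (p.1.2 i), p.1.2), fun b hb => ?_, fun j => ?_⟩, ?_, ?_⟩⟩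
  · by_cases hba : b = a
    · simp [hba]
    · simpa [hba] using p.2.1 b (by simp [hocc, hba, hb])
  · refine (chain_update (hoff j) _ _).2 ?_
    have := p.2.2 j
    by_cases hj : j = i
    · subst hj
      simp only [Function.update_self, chain_cons, crossing_over] at this ⊢
      obtain ⟨m, ⟨-, rfl⟩, hm⟩ := this
      exact hm
    · simpa [hj] using this
  · simp only [hocc, not_or] at hb
    simpa [hb.1] using p.2.1 b hb.2
  · have := p.2.2 j
    by_cases hj : j = i
    · subst hj
      simp only [Function.update_self, chain_cons, crossing_over] at this ⊢
      exact ⟨_, ⟨trivial, rfl⟩, (chain_update hl _ _).2 this⟩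
    · simp only [ne_eq, hj, not_false_eq_true, Function.update_of_ne] at this ⊢
      exact (chain_update (ha j hj) _ _).2 this
  · rintro ⟨⟨c, b⟩, hc, hb⟩
    refine Subtype.ext (Prod.ext ?_ rfl)
    have := hb i
    simp only [Function.update_self, chain_cons, crossing_over] at this
    obtain ⟨m, ⟨h, -⟩, -⟩ := this
    simp [← h]
  · rintro ⟨⟨c, b⟩, hc, hb⟩
    refine Subtype.ext (Prod.ext ?_ rfl)
    have := hc a hna
    simp only at this
    simp [← this]

end Coloring

end VirtualLinks

namespace VirtualLinks

/-! ### Invariance of the number of colourings under the moves. -/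

section Invariance

variable {G : Type*} [Group G] {μ : ℕ}

namespace GaussDiagram

theorem endpoint_unique (D : GaussDiagram μ) {i j : Fin μ} {e e' : Endpoint}
    (he : e ∈ D.word i) (he' : e' ∈ D.word j) (hc : e.chord = e'.chord)
    (ho : e.isOver = e'.isOver) : e = e' := by
  refine List.inj_on_of_nodup_map D.nodup (List.mem_flatten.2 ⟨_, ?_, he⟩)
    (List.mem_flatten.2 ⟨_, ?_, he'⟩) (by simp [hc, ho])
  all_goals exact (List.mem_ofFn' _ _).2 ⟨_, rfl⟩

theorem separated (D : GaussDiagram μ) : Separated D.word := by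
  have h := List.nodup_flatten.1 (List.Nodup.of_map _ D.nodup)
  refine ⟨fun i => h.1 _ ((List.mem_ofFn' _ _).2 ⟨i, rfl⟩), fun i j e hi hj => ?_⟩
  have h2 := List.pairwise_ofFn.1 h.2
  rcases lt_trichotomy i j with hij | hij | hij
  · exact (h2 hij hi hj).elim
  · exact hij
  · exact (h2 hij hj hi).elim

/-- Pairing supplies the opposite endpoint with the same sign, and the absence of repeated keys
excludes any third one. -/
theorem eq_of_chord (D : GaussDiagram μ) {i j : Fin μ} {e : Endpoint} {a : ℕ} {o : Bool} {s : ℤˣ}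
    (h : (⟨a, o, s⟩ : Endpoint) ∈ D.word i) (he : e ∈ D.word j) (hc : e.chord = a) :
    e = ⟨a, true, s⟩ ∨ e = ⟨a, false, s⟩ := by
  obtain ⟨k, hk⟩ := D.paired i _ h
  rcases e with ⟨b, o', s'⟩
  obtain rfl : b = a := hc
  by_cases ho : o' = o
  · subst ho
    obtain rfl : s' = s := congrArg Endpoint.sign (D.endpoint_unique he h rfl rfl)
    cases o' <;> simp
  · have ho' : o' = !o := by cases o <;> cases o' <;> simp_all
    subst ho'
    obtain rfl : s' = s := congrArg Endpoint.sign (D.endpoint_unique he hk rfl rfl)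
    cases o <;> simp

theorem FollowsSigned.exists_rotated {D : GaussDiagram μ} {s : ℤˣ} {x y : Endpoint}
    (h : D.FollowsSigned s x y) : ∃ i l, (s = 1 ∧ (D.word i).IsRotated (x :: y :: l)) ∨
      (s = -1 ∧ (D.word i).IsRotated (y :: x :: l)) := by
  rcases h with ⟨hs, i, l, h⟩ | ⟨hs, i, l, h⟩
  · exact ⟨i, l, Or.inl ⟨hs, h⟩⟩
  · exact ⟨i, l, Or.inr ⟨hs, h⟩⟩

end GaussDiagram

open GaussDiagram

theorem coloring_relabel (w w' : Fin μ → List Endpoint) (f : Equiv.Perm ℕ)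
    (h : ∀ i, w' i = (w i).map fun e => ⟨f e.chord, e.isOver, e.sign⟩) :
    Nonempty (Coloring G w ≃ Coloring G w') := by
  have hocc : ∀ a, Occurs w' a ↔ Occurs w (f.symm a) := by
    intro a
    simp only [Occurs, h, List.mem_map]
    constructor
    · rintro ⟨i, _, ⟨e, he, rfl⟩, rfl⟩
      exact ⟨i, e, he, by simp⟩
    · rintro ⟨i, e, he, hea⟩
      exact ⟨i, _, ⟨e, he, rfl⟩, by simp [hea]⟩
  refine coloring_fiberwise (Equiv.arrowCongr f (Equiv.refl G)) (fun c => ?_) fun c =>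
    nonempty_pi_equiv fun i => ⟨Equiv.subtypeEquivRight fun g => ?_⟩
  · simp only [hocc, Equiv.arrowCongr_apply, Equiv.coe_refl, Function.comp_apply, id_eq]
    exact ⟨fun h a => h _, fun h a => by simpa using h (f a)⟩
  · rw [h, chain_map]
    refine chain_congr (fun e _ => ?_) _ _
    ext g k
    simp [crossing]

theorem coloring_reorder (w w' : Fin μ → List Endpoint) (f : Equiv.Perm (Fin μ))
    (h : ∀ i, w' i = w (f i)) : Nonempty (Coloring G w ≃ Coloring G w') := by
  obtain rfl : w' = fun i => w (f i) := funext h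
  have hocc : ∀ a, Occurs (fun i => w (f i)) a ↔ Occurs w a := fun a =>
    f.exists_congr_left.trans (by simp [Occurs])
  refine coloring_fiberwise (Equiv.refl _) (fun c => by simp [hocc]) fun c => ?_
  exact ⟨(Equiv.piCongrLeft (fun i => ClosedState (crossing c) (w i)) f).symm⟩

theorem isRotated_filter {l l' : List Endpoint} (p : Endpoint → Bool) (h : l.IsRotated l') :
    (l.filter p).IsRotated (l'.filter p) := by
  obtain ⟨n, hn, rfl⟩ := List.isRotated_iff_mod.1 h
  rw [List.rotate_eq_drop_append_take hn, List.filter_append]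
  conv_lhs => rw [← List.take_append_drop n l, List.filter_append]
  exact List.isRotated_append

theorem isRotated_filter_append {w u l : List Endpoint} {p : Endpoint → Bool}
    (h : w.IsRotated (u ++ l)) (hu : ∀ e ∈ u, p e = false) (hl : ∀ e ∈ l, p e = true) :
    (w.filter p).IsRotated l := by
  have h1 := isRotated_filter p h
  have hu' : u.filter p = [] := List.filter_eq_nil_iff.2 fun e he => by simp [hu e he]
  rwa [List.filter_append, hu', List.filter_eq_self.2 hl, List.nil_append] at h1

/-- Two neighbouring tails lie on one arc as far as colours are concerned, so their chords must have
equal colours. -/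
theorem isEmpty_closedState {c : ℕ → G} {x y : ℕ} {sx sy : ℤˣ} {w l : List Endpoint}
    (hw : w.IsRotated (⟨x, true, sx⟩ :: ⟨y, true, sy⟩ :: l)) (hc : c x ≠ c y) :
    IsEmpty (ClosedState (crossing c) w) := by
  obtain ⟨e⟩ := closedState_rotate (partialBij_crossing c) hw
  refine ⟨fun g => hc ?_⟩
  obtain ⟨m, ⟨h1, h2⟩, m', ⟨h3, -⟩, -⟩ := by
    simpa only [chain_cons, crossing_over] using (e g).2
  rw [h1, h3, h2]

/-- A colour commutes with its own powers, so the head of the isolated chord does nothing where its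
tail is defined; what is left is an orphan tail. -/
theorem coloring_r1 {D D' : GaussDiagram μ} (a : ℕ) (s o : ℤˣ)
    (hadj : D.FollowsSigned o ⟨a, true, s⟩ ⟨a, false, s⟩) (h : IsErase {a} D D') :
    Nonempty (Coloring G D.word ≃ Coloring G D'.word) := by
  obtain ⟨i, u, l, hu, hul, hw⟩ : ∃ i u l,
      (∀ (c : ℕ → G) g h, Chain (crossing c) g u h ↔
        Chain (crossing c) g [⟨a, true, s⟩] h) ∧
      u.Perm [⟨a, true, s⟩, ⟨a, false, s⟩] ∧ (D.word i).IsRotated (u ++ l) := by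
    obtain ⟨i, l, ⟨-, h⟩ | ⟨-, h⟩⟩ := hadj.exists_rotated
    · refine ⟨i, [⟨a, true, s⟩, ⟨a, false, s⟩], l, fun c g h => ?_, List.Perm.refl _, h⟩
      simp only [chain_cons, crossing_over, crossing_under, chain_nil]
      constructor
      · rintro ⟨m, ⟨rfl, rfl⟩, m', rfl, rfl⟩
        exact ⟨c a, ⟨rfl, rfl⟩, by group⟩
      · rintro ⟨m, ⟨rfl, rfl⟩, rfl⟩
        exact ⟨c a, ⟨rfl, rfl⟩, c a, by group, rfl⟩
    · refine ⟨i, [⟨a, false, s⟩, ⟨a, true, s⟩], l, fun c g h => ?_, List.Perm.swap _ _ _, h⟩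
      simp only [chain_cons, crossing_over, crossing_under, chain_nil]
      constructor
      · rintro ⟨m, hm, m', ⟨rfl, rfl⟩, rfl⟩
        have : c a = g := by
          rw [eq_comm, mul_assoc, inv_mul_eq_iff_eq_mul] at hm
          have h2 : c a ^ (s : ℤ) * c a = c a * c a ^ (s : ℤ) :=
            (Commute.zpow_self (c a) _).eq
          rw [h2] at hm
          exact (mul_right_cancel hm).symm
        exact ⟨c a, ⟨this, this⟩, rfl⟩
      · rintro ⟨m, ⟨rfl, rfl⟩, rfl⟩
        exact ⟨c a, by group, c a, ⟨rfl, rfl⟩, rfl⟩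
  have hmem : ∀ e, e ∈ u ↔ e = ⟨a, true, s⟩ ∨ e = ⟨a, false, s⟩ := fun e => by
    simp [hul.mem_iff]
  have hx : (⟨a, true, s⟩ : Endpoint) ∈ D.word i := hw.mem_iff.2 (by simp [hmem])
  have hnd := List.nodup_append.1 (hw.nodup_iff.1 (D.separated.1 i))
  have hl : ∀ e ∈ l, e.chord ≠ a := fun e he hc =>
    hnd.2.2 e ((hmem e).2 (D.eq_of_chord hx (hw.mem_iff.2 (by simp [he])) hc)) e he rfl
  have hj : ∀ j, j ≠ i → ∀ e ∈ D.word j, e.chord ≠ a := fun j hji e he hc =>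
    hji (D.separated.2 j i e he (hw.mem_iff.2
      (by simp [(hmem e).2 (D.eq_of_chord hx he hc)])))
  have e1 : Nonempty (Coloring G D.word ≃
      Coloring G (Function.update D.word i (⟨a, true, s⟩ :: l))) := by
    have hocc : ∀ b, Occurs D.word b ↔
        Occurs (Function.update D.word i (⟨a, true, s⟩ :: l)) b := by
      intro b
      refine exists_congr fun j => ?_
      by_cases hji : j = i
      · subst hji
        simp [hw.mem_iff, hmem, or_and_right, exists_or]
      · simp [hji]
    refine coloring_fiberwise (Equiv.refl _) (fun c => by simp [hocc]) fun c =>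
      nonempty_pi_equiv fun j => ?_
    by_cases hji : j = i
    · subst hji
      exact closedState_local (partialBij_crossing c) (partialBij_crossing c) hw
        (u' := [⟨a, true, s⟩]) (by simp [List.IsRotated.refl]) (hu c) fun _ _ => rfl
    · simp only [ne_eq, hji, not_false_eq_true, Function.update_of_ne]
      exact ⟨Equiv.refl _⟩
  have e2 := coloring_orphan (G := G) D.word i a s l hl hj
  have e3 : Nonempty (Coloring G (Function.update D.word i l) ≃ Coloring G D'.word) := by
    refine coloring_rotate fun j => ?_
    rw [h j]
    by_cases hji : j = i
    · subst hji
      rw [Function.update_self]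
      refine (isRotated_filter_append hw (fun e he => ?_) fun e he => ?_).symm
      · rcases (hmem e).1 he with rfl | rfl <;> simp
      · simpa using hl e he
    · rw [Function.update_of_ne hji, List.filter_eq_self.2]
      intro e he
      simpa using hj j hji e he
  exact ⟨(e1.some.trans e2.some).trans e3.some⟩

/-- The neighbouring tails force equal colours on the two chords, and then the heads, of opposite
signs, act by inverse conjugations. Erasing the heads leaves two orphan tails. -/
theorem coloring_r2 {D D' : GaussDiagram μ} (a b : ℕ) (s p q : ℤˣ) (hab : a ≠ b)
    (hover : D.FollowsSigned p ⟨a, true, s⟩ ⟨b, true, -s⟩)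
    (hunder : D.FollowsSigned q ⟨a, false, s⟩ ⟨b, false, -s⟩)
    (h : IsErase {a, b} D D') :
    Nonempty (Coloring G D.word ≃ Coloring G D'.word) := by
  classical
  obtain ⟨i, x, y, l, hxy, hw⟩ : ∃ i x y l, ((x, y) = (a, b) ∨ (x, y) = (b, a)) ∧
      ∃ sx sy : ℤˣ, (D.word i).IsRotated (⟨x, true, sx⟩ :: ⟨y, true, sy⟩ :: l) := by
    obtain ⟨i, l, ⟨-, h⟩ | ⟨-, h⟩⟩ := hover.exists_rotated
    · exact ⟨i, a, b, l, Or.inl rfl, s, -s, h⟩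
    · exact ⟨i, b, a, l, Or.inr rfl, -s, s, h⟩
  obtain ⟨sx, sy, hw⟩ := hw
  obtain ⟨k, u, m, hum, hu, hv⟩ : ∃ k u m, u.Perm [⟨a, false, s⟩, ⟨b, false, -s⟩] ∧
      (∀ c : ℕ → G, c a = c b → ∀ g h, Chain (crossing c) g u h ↔ Chain (crossing c) g [] h) ∧
      (D.word k).IsRotated (u ++ m) := by
    have key : ∀ (c : ℕ → G) (t : ℤˣ), ∀ x y, c x = c y → ∀ g h,
        Chain (crossing c) g [⟨x, false, t⟩, ⟨y, false, -t⟩] h ↔ Chain (crossing c) g [] h := by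
      intro c t x y hc g h
      simp only [chain_cons, crossing_under, chain_nil, hc]
      constructor
      · rintro ⟨m, rfl, m', rfl, rfl⟩
        simp [mul_assoc]
      · rintro rfl
        exact ⟨_, rfl, g, by simp [mul_assoc], rfl⟩
    obtain ⟨i, l, ⟨-, h⟩ | ⟨-, h⟩⟩ := hunder.exists_rotated
    · exact ⟨i, _, l, List.Perm.refl _, fun c hc => key c s a b hc, h⟩
    · refine ⟨i, [⟨b, false, -s⟩, ⟨a, false, s⟩], l, List.Perm.swap _ _ _, fun c hc => ?_, h⟩
      simpa using key c (-s) b a hc.symm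
  have hX : (⟨x, true, sx⟩ : Endpoint) ∈ D.word i := hw.mem_iff.2 (by simp)
  have hY : (⟨y, true, sy⟩ : Endpoint) ∈ D.word i := hw.mem_iff.2 (by simp)
  have hxyne : x ≠ y := by
    rcases hxy with hxy | hxy <;> cases hxy
    exacts [hab, hab.symm]
  have hmemu : ∀ e, e ∈ u ↔ e = ⟨a, false, s⟩ ∨ e = ⟨b, false, -s⟩ := fun e => by
    simp [hum.mem_iff]
  have hsub : ∀ e ∈ u, e ∈ D.word k := fun e he => hv.mem_iff.2 (by simp [he])
  have hchu : ∀ e ∈ u, e.chord = x ∨ e.chord = y := by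
    intro e he
    rcases hxy with hxy | hxy <;> cases hxy <;> rcases (hmemu e).1 he with rfl | rfl <;> simp
  have hchord : ∀ j, ∀ e ∈ D.word j, e ∉ u → e.chord = x ∨ e.chord = y →
      e = ⟨x, true, sx⟩ ∨ e = ⟨y, true, sy⟩ := by
    intro j e he heu hc
    have hover : e.isOver = true := by
      by_contra hov
      refine heu ((hmemu e).2 ?_)
      have hA := hsub _ ((hmemu ⟨a, false, s⟩).2 (Or.inl rfl))
      have hB := hsub _ ((hmemu ⟨b, false, -s⟩).2 (Or.inr rfl))
      have hc' : e.chord = a ∨ e.chord = b := by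
        rcases hxy with hxy | hxy <;> cases hxy
        exacts [hc, hc.symm]
      refine hc'.imp (fun h => D.endpoint_unique he hA h ?_)
        (fun h => D.endpoint_unique he hB h ?_) <;> simpa using hov
    exact hc.imp (fun h => D.endpoint_unique he hX h hover)
      (fun h => D.endpoint_unique he hY h hover)
  have hnu : ∀ (z : ℕ) (t : ℤˣ), (⟨z, true, t⟩ : Endpoint) ∉ u := fun z t hz => by
    rcases (hmemu _).1 hz with h | h <;> cases h
  -- An intermediate word family that need not be a Gauss diagram: the heads are erased, the tails
  -- remain.
  set w₁ : Fin μ → List Endpoint := fun j => (D.word j).filter fun e => e ∉ u with hw₁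
  set l₁ := l.filter fun e => e ∉ u with hl₁
  have hw₁i : (w₁ i).IsRotated (⟨x, true, sx⟩ :: ⟨y, true, sy⟩ :: l₁) := by
    have := isRotated_filter (fun e => e ∉ u) hw
    rwa [List.filter_cons_of_pos (by simp [hnu]), List.filter_cons_of_pos (by simp [hnu])] at this
  have hl₁c : ∀ e ∈ l₁, e.chord ≠ x ∧ e.chord ≠ y := by
    have hnd := hw.nodup_iff.1 (D.separated.1 i)
    simp only [List.nodup_cons, List.mem_cons, not_or] at hnd
    intro e he
    simp only [hl₁, List.mem_filter, decide_eq_true_eq] at he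
    have := hchord i e (hw.mem_iff.2 (by simp [he.1])) he.2
    rw [← not_or]
    intro hc
    rcases this hc with rfl | rfl
    · exact hnd.1.2 he.1
    · exact hnd.2.1 he.1
  have hw₁c : ∀ j, j ≠ i → ∀ e ∈ w₁ j, e.chord ≠ x ∧ e.chord ≠ y := by
    intro j hj e he
    simp only [hw₁, List.mem_filter, decide_eq_true_eq] at he
    rw [← not_or]
    intro hc
    rcases hchord j e he.1 he.2 hc with rfl | rfl
    · exact hj (D.separated.2 _ _ _ he.1 hX)
    · exact hj (D.separated.2 _ _ _ he.1 hY)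
  have e1 : Nonempty (Coloring G D.word ≃ Coloring G w₁) := by
    have hocc : ∀ z, Occurs D.word z ↔ Occurs w₁ z := by
      intro z
      constructor
      · rintro ⟨j, e, he, rfl⟩
        by_cases heu : e ∈ u
        · rcases hchu e heu with h | h
          · exact ⟨i, ⟨x, true, sx⟩, hw₁i.mem_iff.2 (by simp), h.symm⟩
          · exact ⟨i, ⟨y, true, sy⟩, hw₁i.mem_iff.2 (by simp), h.symm⟩
        · exact ⟨j, e, by simp [hw₁, he, heu], rfl⟩
      · rintro ⟨j, e, he, rfl⟩
        exact ⟨j, e, List.mem_of_mem_filter he, rfl⟩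
    refine coloring_fiberwise (Equiv.refl _) (fun c => by simp [hocc]) fun c => ?_
    -- For unequal colours the heads do not cancel, but the tails, present in both families, leave
    -- no closed state on either side.
    by_cases hc : c a = c b
    · refine nonempty_pi_equiv fun j => ?_
      by_cases hj : j = k
      · subst hj
        have hnd := List.nodup_append.1 (hv.nodup_iff.1 (D.separated.1 j))
        refine closedState_local (partialBij_crossing c) (partialBij_crossing c) hv (u' := [])
          (isRotated_filter_append hv (fun e he => by simpa using he) fun e he => ?_)
          (hu c hc) fun _ _ => rfl
        have : e ∉ u := fun h => hnd.2.2 e h e he rfl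
        simpa using this
      · have : w₁ j = D.word j := List.filter_eq_self.2 fun e he => by
          have : e ∉ u := fun h => hj (D.separated.2 _ _ _ he (hsub e h))
          simpa using this
        rw [this]
        exact ⟨Equiv.refl _⟩
    · have hc' : c x ≠ c y := by
        rcases hxy with hxy | hxy <;> cases hxy
        exacts [hc, fun h => hc h.symm]
      have h1 := isEmpty_closedState hw hc'
      have h2 := isEmpty_closedState hw₁i hc'
      have : IsEmpty (∀ j, ClosedState (crossing c) (D.word j)) := ⟨fun f => h1.elim (f i)⟩
      have : IsEmpty (∀ j, ClosedState (crossing (Equiv.refl (ℕ → G) c)) (w₁ j)) := ⟨fun f => h2.elim (f i)⟩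
      exact ⟨Equiv.equivOfIsEmpty _ _⟩
  have e2 : Nonempty (Coloring G w₁ ≃
      Coloring G (Function.update w₁ i (⟨x, true, sx⟩ :: ⟨y, true, sy⟩ :: l₁))) := by
    refine coloring_rotate fun j => ?_
    by_cases hj : j = i
    · subst hj
      simpa using hw₁i
    · simp [hj, List.IsRotated.refl]
  have e3 := coloring_orphan (G := G) w₁ i x sx (⟨y, true, sy⟩ :: l₁)
    (by simpa [hxyne.symm] using fun e he => (hl₁c e he).1) fun j hj e he => (hw₁c j hj e he).1
  have e4 := coloring_orphan (G := G) w₁ i y sy l₁ (fun e he => (hl₁c e he).2)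
    fun j hj e he => (hw₁c j hj e he).2
  have hpair : ∀ z, z ∈ ({a, b} : Finset ℕ) ↔ z = x ∨ z = y := by
    rcases hxy with hxy | hxy <;> cases hxy <;> simp [or_comm]
  have hfil : ∀ j, (w₁ j).filter (fun e => e.chord ∉ ({a, b} : Finset ℕ)) = D'.word j := by
    intro j
    rw [h j, hw₁, List.filter_filter]
    refine List.filter_congr fun e _ => ?_
    by_cases heu : e ∈ u
    · simp [heu, -Finset.mem_insert, (hpair _).2 (hchu e heu)]
    · simp [heu]
  have e5 : Nonempty (Coloring G (Function.update w₁ i l₁) ≃ Coloring G D'.word) := by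
    refine coloring_rotate fun j => ?_
    rw [← hfil]
    by_cases hj : j = i
    · subst hj
      rw [Function.update_self]
      refine (isRotated_filter_append (u := [_, _]) hw₁i (fun e he => ?_) fun e he => ?_).symm
      · simp only [hpair, decide_eq_false_iff_not, not_not]
        rcases List.mem_pair.1 he with rfl | rfl <;> simp
      · simpa only [hpair, decide_eq_true_eq, not_or] using hl₁c e he
    · rw [Function.update_of_ne hj, List.filter_eq_self.2]
      intro e he
      simpa only [hpair, decide_eq_true_eq, not_or] using hw₁c j hj e he
  exact ⟨(((e1.some.trans e2.some).trans e3.some).trans e4.some).trans e5.some⟩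

/-- Conjugating the colour of the chord `d` by a power of the colour of the chord `a`. -/
def conjAt {a d : ℕ} (had : a ≠ d) (n : ℤ) : (ℕ → G) ≃ (ℕ → G) where
  toFun c := Function.update c d (c a ^ n * c d * (c a ^ n)⁻¹)
  invFun c := Function.update c d ((c a ^ n)⁻¹ * c d * c a ^ n)
  left_inv c := by
    ext b
    by_cases hb : b = d
    · subst hb
      simp [had, mul_assoc]
    · simp [hb]
  right_inv c := by
    ext b
    by_cases hb : b = d
    · subst hb
      simp [had, mul_assoc]
    · simp [hb]

theorem closedState_swap_signed {X : Type*} {σ σ' : Endpoint → X → X → Prop} (hσ : PartialBij σ)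
    (hσ' : PartialBij σ') {w : Fin μ → List Endpoint} (hw : Separated w) {i : Fin μ} {s : ℤˣ}
    {x y : Endpoint} {l : List Endpoint}
    (hxy : (s = 1 ∧ (w i).IsRotated (x :: y :: l)) ∨ (s = -1 ∧ (w i).IsRotated (y :: x :: l)))
    (hpos : s = 1 → ∀ g h, Chain σ g [x, y] h ↔ Chain σ' g [y, x] h)
    (hneg : s = -1 → ∀ g h, Chain σ g [y, x] h ↔ Chain σ' g [x, y] h)
    (hother : ∀ j, ∀ e ∈ w j, e ≠ x → e ≠ y → σ e = σ' e) (j : Fin μ) :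
    Nonempty (ClosedState σ (w j) ≃ ClosedState σ' ((w j).map (Equiv.swap x y))) := by
  rcases hxy with ⟨hs, hxy⟩ | ⟨hs, hxy⟩
  · exact closedState_swap hσ hσ' hw hxy (hpos hs) hother j
  · rw [Equiv.swap_comm]
    exact closedState_swap hσ hσ' hw hxy (hneg hs) (fun j e he h1 h2 => hother j e he h2 h1) j

theorem rotated_map_swap {w : List Endpoint} {s : ℤˣ} {x y u v : Endpoint} {l : List Endpoint}
    (h : (s = 1 ∧ w.IsRotated (x :: y :: l)) ∨ (s = -1 ∧ w.IsRotated (y :: x :: l)))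
    (hxu : x ≠ u) (hxv : x ≠ v) (hyu : y ≠ u) (hyv : y ≠ v) :
    (s = 1 ∧ (w.map (Equiv.swap u v)).IsRotated (x :: y :: l.map (Equiv.swap u v))) ∨
      (s = -1 ∧ (w.map (Equiv.swap u v)).IsRotated (y :: x :: l.map (Equiv.swap u v))) := by
  refine h.imp (fun h => ⟨h.1, ?_⟩) (fun h => ⟨h.1, ?_⟩) <;>
  · have := h.2.map (Equiv.swap u v)
    rwa [List.map_cons, List.map_cons, Equiv.swap_apply_of_ne_of_ne hxu hxv,
      Equiv.swap_apply_of_ne_of_ne hyu hyv] at this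

theorem exists_mem_map_swap {w : Fin μ → List Endpoint} {i : Fin μ} {x y : Endpoint}
    (hx : x ∈ w i) (hy : y ∈ w i) (e : Endpoint) :
    (∃ m, e ∈ (w m).map (Equiv.swap x y)) ↔ ∃ m, e ∈ w m := by
  have hmem : ∀ m, e ∈ (w m).map (Equiv.swap x y) ↔ Equiv.swap x y e ∈ w m := fun m => by
    simp only [List.mem_map, Equiv.swap_apply_eq_iff, exists_eq_right]
  simp only [hmem]
  by_cases h1 : e = x
  · subst h1
    rw [Equiv.swap_apply_left]
    exact ⟨fun _ => ⟨i, hx⟩, fun _ => ⟨i, hy⟩⟩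
  · by_cases h2 : e = y
    · subst h2
      rw [Equiv.swap_apply_right]
      exact ⟨fun _ => ⟨i, hy⟩, fun _ => ⟨i, hx⟩⟩
    · rw [Equiv.swap_apply_of_ne_of_ne h1 h2]

theorem occurs_map_swap {w : Fin μ → List Endpoint} {i : Fin μ} {x y : Endpoint}
    (hx : x ∈ w i) (hy : y ∈ w i) (z : ℕ) :
    Occurs (fun m => (w m).map (Equiv.swap x y)) z ↔ Occurs w z := by
  have h : ∀ v : Fin μ → List Endpoint, Occurs v z ↔ ∃ e, (∃ m, e ∈ v m) ∧ e.chord = z :=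
    fun v => ⟨fun ⟨m, e, he, h⟩ => ⟨e, ⟨m, he⟩, h⟩, fun ⟨e, ⟨m, he⟩, h⟩ => ⟨m, e, he, h⟩⟩
  simp only [h, exists_mem_map_swap hx hy]

theorem chain_pair {X : Type*} (σ : Endpoint → X → X → Prop) (g h : X) (x y : Endpoint) :
    Chain σ g [x, y] h ↔ ∃ m, σ x g m ∧ σ y m h := by
  simp

/-- Covers both orders on the bottom strand: `A` is the action of the top strand, `Y` and `Z` that
of the middle strand on the two sides of it. -/
theorem conj_comm_iff {A Y Z : G} (hA : A * Y = Z * A) (g h : G) :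
    h = Y⁻¹ * (A⁻¹ * g * A) * Y ↔ h = A⁻¹ * (Z⁻¹ * g * Z) * A := by
  have h1 : Y⁻¹ * (A⁻¹ * g * A) * Y = (A * Y)⁻¹ * g * (A * Y) := by group
  have h2 : A⁻¹ * (Z⁻¹ * g * Z) * A = (Z * A)⁻¹ * g * (Z * A) := by group
  rw [h1, h2, hA]

/-- The crossing `d` of the middle and bottom strands passes to the other side of the top strand, so
its colour is conjugated by a power of the colour of `a`; the other chords keep theirs. The top
strand forces equal colours at `a` and `b`. The three exchanges are then treated one at a time. -/
theorem coloring_r3 {D D' : GaussDiagram μ} (a b d : ℕ) (p q r t : ℤˣ)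
    (hab : a ≠ b) (had : a ≠ d) (hbd : b ≠ d)
    (htop : D.FollowsSigned p ⟨a, true, t * p * q⟩ ⟨b, true, t * p * r⟩)
    (hmid : D.FollowsSigned q ⟨a, false, t * p * q⟩ ⟨d, true, t * q * r⟩)
    (hbot : D.FollowsSigned r ⟨b, false, t * p * r⟩ ⟨d, false, t * q * r⟩)
    (h : IsMap
      (Equiv.swap ⟨a, true, t * p * q⟩ ⟨b, true, t * p * r⟩ ∘
        Equiv.swap ⟨a, false, t * p * q⟩ ⟨d, true, t * q * r⟩ ∘
        Equiv.swap ⟨b, false, t * p * r⟩ ⟨d, false, t * q * r⟩) D D') :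
    Nonempty (Coloring G D.word ≃ Coloring G D'.word) := by
  classical
  obtain ⟨i, li, hi⟩ := htop.exists_rotated
  obtain ⟨j, lj, hj⟩ := hmid.exists_rotated
  obtain ⟨k, lk, hk⟩ := hbot.exists_rotated
  set au : Endpoint := ⟨a, false, t * p * q⟩ with hau
  set ao : Endpoint := ⟨a, true, t * p * q⟩ with hao
  set bu : Endpoint := ⟨b, false, t * p * r⟩ with hbu
  set bo : Endpoint := ⟨b, true, t * p * r⟩ with hbo
  set du : Endpoint := ⟨d, false, t * q * r⟩ with hdu
  set do' : Endpoint := ⟨d, true, t * q * r⟩ with hdo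
  have hdmem : ∀ m, ∀ e ∈ D.word m, e.chord = d → e = do' ∨ e = du := by
    have : do' ∈ D.word j := by
      rcases hj with ⟨-, hj⟩ | ⟨-, hj⟩ <;> exact hj.mem_iff.2 (by simp)
    exact fun m e he hc => D.eq_of_chord this he hc
  set w₁ : Fin μ → List Endpoint := fun m => (D.word m).map (Equiv.swap bu du) with hw₁
  set w₂ : Fin μ → List Endpoint := fun m => (w₁ m).map (Equiv.swap au do') with hw₂
  have hw₃ : ∀ m, D'.word m = (w₂ m).map (Equiv.swap ao bo) := fun m => by
    rw [h m, hw₂, hw₁]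
    simp [List.map_map]
  have hs₁ : Separated w₁ := D.separated.map _
  have hs₂ : Separated w₂ := hs₁.map _
  have hj₁ := rotated_map_swap hj (u := bu) (v := du) (by simp [hau, hbu, hab])
    (by simp [hau, hdu, had]) (by simp [hdo, hbu]) (by simp [hdo, hdu])
  have hi₁ := rotated_map_swap hi (u := bu) (v := du) (by simp [hao, hbu])
    (by simp [hao, hdu]) (by simp [hbo, hbu]) (by simp [hbo, hdu])
  have hi₂ := rotated_map_swap hi₁ (u := au) (v := do') (by simp [hao, hau])
    (by simp [hao, hdo, had]) (by simp [hbo, hau]) (by simp [hbo, hdo, hbd])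
  have hkm : bu ∈ D.word k ∧ du ∈ D.word k := by
    rcases hk with ⟨-, hk⟩ | ⟨-, hk⟩ <;> exact ⟨hk.mem_iff.2 (by simp), hk.mem_iff.2 (by simp)⟩
  have hjm : au ∈ w₁ j ∧ do' ∈ w₁ j := by
    rcases hj₁ with ⟨-, hj⟩ | ⟨-, hj⟩ <;> exact ⟨hj.mem_iff.2 (by simp), hj.mem_iff.2 (by simp)⟩
  have him : ao ∈ w₂ i ∧ bo ∈ w₂ i := by
    rcases hi₂ with ⟨-, hi⟩ | ⟨-, hi⟩ <;> exact ⟨hi.mem_iff.2 (by simp), hi.mem_iff.2 (by simp)⟩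
  have hocc : ∀ z, Occurs D'.word z ↔ Occurs D.word z := fun z => by
    rw [show D'.word = fun m => (w₂ m).map (Equiv.swap ao bo) from funext hw₃,
      occurs_map_swap him.1 him.2, occurs_map_swap hjm.1 hjm.2, occurs_map_swap hkm.1 hkm.2]
  -- The exponent is the sign of `a` times `q`: the sign of `a` if the middle strand meets `a`
  -- before `d`, its opposite otherwise.
  refine coloring_fiberwise (conjAt had ((t * p : ℤˣ) : ℤ)) (fun c => ?_) fun c => ?_
  · refine forall_congr' fun z => ?_
    rw [hocc]
    refine imp_congr_right fun _ => ?_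
    by_cases hz : z = d
    · subst hz
      simp [conjAt]
    · simp [conjAt, hz]
  set c' := conjAt had ((t * p : ℤˣ) : ℤ) c with hc'
  have hc'd : c' d = c a ^ ((t * p : ℤˣ) : ℤ) * c d * (c a ^ ((t * p : ℤˣ) : ℤ))⁻¹ := by
    simp [hc', conjAt]
  have hc'z : ∀ z, z ≠ d → c' z = c z := fun z hz => by simp [hc', conjAt, hz]
  by_cases hc : c a = c b
  -- After the bottom exchange alone, the head of `d` already uses the new colour while its tail
  -- still uses the old one, so the intermediate transport comes from no chord colouring.
  · let σ : Endpoint → G → G → Prop := fun e => if e = du then crossing c' e else crossing c e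
    have hσ : PartialBij σ := by
      intro e
      by_cases he : e = du
      · simpa [σ, he] using partialBij_crossing c' du
      · simpa [σ, he] using partialBij_crossing c e
    have hσne : ∀ e, e ≠ du → σ e = crossing c e := fun e he => if_neg he
    have hσdu : σ du = crossing c' du := if_pos rfl
    have hb : ∀ m, Nonempty (ClosedState (crossing c) (D.word m) ≃ ClosedState σ (w₁ m)) := by
      refine closedState_swap_signed (partialBij_crossing c) hσ D.separated hk ?_ ?_ ?_
      · intro hr g h
        simp only [chain_pair, hσdu, hσne bu (by simp [hbu, hdu, hbd])]
        simp only [hbu, hdu, crossing_under, exists_eq_left, hr, mul_one, ← hc, hc'd, conj_zpow]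
        exact conj_comm_iff (by group) g h
      · intro hr g h
        simp only [chain_pair, hσdu, hσne bu (by simp [hbu, hdu, hbd])]
        simp only [hbu, hdu, crossing_under, exists_eq_left, hr, mul_neg, mul_one, ← hc, hc'd,
          conj_zpow, Units.val_neg, zpow_neg _ ((t * p : ℤˣ) : ℤ)]
        exact (conj_comm_iff (by group) g h).symm
      · intro m e _ _ he
        rw [hσne e he]
    have hm : ∀ m, Nonempty (ClosedState σ (w₁ m) ≃ ClosedState (crossing c') (w₂ m)) := by
      refine closedState_swap_signed hσ (partialBij_crossing c') hs₁ hj₁ ?_ ?_ ?_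
      · intro hq g h
        simp only [chain_pair, hσne do' (by simp [hdo, hdu]),
          hσne au (by simp [hau, hdu, had])]
        simp only [hau, hdo, crossing_under, crossing_over, exists_eq_left, hq, mul_one, hc'd,
          hc'z a had]
        generalize c a ^ ((t * p : ℤˣ) : ℤ) = K
        constructor
        · rintro ⟨h1, h2⟩
          exact ⟨g, ⟨by rw [h1]; group, rfl⟩, h2⟩
        · rintro ⟨m, ⟨h1, rfl⟩, h2⟩
          exact ⟨by rw [← h1]; group, h2⟩
      · intro hq g h
        simp only [chain_pair, hσne do' (by simp [hdo, hdu]),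
          hσne au (by simp [hau, hdu, had])]
        simp only [hau, hdo, crossing_under, crossing_over, exists_eq_left, hq, mul_neg, mul_one,
          hc'd, hc'z a had, Units.val_neg, zpow_neg]
        generalize c a ^ ((t * p : ℤˣ) : ℤ) = K
        constructor
        · rintro ⟨m, ⟨h1, rfl⟩, h2⟩
          exact ⟨by rw [h1]; group, h2⟩
        · rintro ⟨h1, h2⟩
          refine ⟨g, ⟨?_, rfl⟩, h2⟩
          rw [inv_inv] at h1
          exact mul_left_cancel (mul_right_cancel h1)
      · intro m e he _ hed
        by_cases hedu : e = du
        · rw [hedu, hσdu]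
        · rw [hσne e hedu]
          refine crossing_congr (hc'z _ fun hcd => ?_).symm
          obtain ⟨m', he'⟩ := (exists_mem_map_swap hkm.1 hkm.2 e).1 ⟨m, he⟩
          exact (hdmem m' e he' hcd).elim hed hedu
    have ht : ∀ m, Nonempty (ClosedState (crossing c') (w₂ m) ≃
        ClosedState (crossing c') (D'.word m)) := by
      simp only [hw₃]
      refine closedState_swap_signed (partialBij_crossing c') (partialBij_crossing c') hs₂ hi₂
        ?_ ?_ fun _ _ _ _ _ => rfl
      · intro _ g h
        simp only [hao, hbo, chain_pair, crossing_over]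
        constructor <;>
        · rintro ⟨m, ⟨h1, rfl⟩, h2, rfl⟩
          exact ⟨h, ⟨h2, rfl⟩, h1, rfl⟩
      · intro _ g h
        simp only [hao, hbo, chain_pair, crossing_over]
        constructor <;>
        · rintro ⟨m, ⟨h1, rfl⟩, h2, rfl⟩
          exact ⟨h, ⟨h2, rfl⟩, h1, rfl⟩
    exact nonempty_pi_equiv fun m => ⟨((hb m).some.trans (hm m).some).trans (ht m).some⟩
  · have hca : c' a ≠ c' b := by rwa [hc'z a had, hc'z b hbd]
    have h1 : IsEmpty (ClosedState (crossing c) (D.word i)) := by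
      rcases hi with ⟨-, hi⟩ | ⟨-, hi⟩
      · exact isEmpty_closedState hi hc
      · exact isEmpty_closedState hi (Ne.symm hc)
    have h2 : IsEmpty (ClosedState (crossing c') (D'.word i)) := by
      rw [hw₃]
      rcases hi₂ with ⟨-, hi₂⟩ | ⟨-, hi₂⟩
      · have := hi₂.map (Equiv.swap ao bo)
        rw [List.map_cons, List.map_cons, Equiv.swap_apply_left, Equiv.swap_apply_right] at this
        exact isEmpty_closedState this (Ne.symm hca)
      · have := hi₂.map (Equiv.swap ao bo)
        rw [List.map_cons, List.map_cons, Equiv.swap_apply_left, Equiv.swap_apply_right] at this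
        exact isEmpty_closedState this hca
    have : IsEmpty (∀ m, ClosedState (crossing c) (D.word m)) := ⟨fun f => h1.elim (f i)⟩
    have : IsEmpty (∀ m, ClosedState (crossing c') (D'.word m)) := ⟨fun f => h2.elim (f i)⟩
    exact ⟨Equiv.equivOfIsEmpty _ _⟩

theorem coloring_move {D D' : GaussDiagram μ} (h : Move D D') :
    Nonempty (Coloring G D.word ≃ Coloring G D'.word) := by
  cases h with
  | relabel f h => exact coloring_relabel _ _ f h
  | rotate h => exact coloring_rotate h
  | reorder f h => exact coloring_reorder _ _ f h
  | r1 a s o hadj h => exact coloring_r1 a s o hadj h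
  | r2 a b s p q hab hover hunder h => exact coloring_r2 a b s p q hab hover hunder h
  | r3 a b c p q r t hab hac hbc htop hmid hbot h =>
    exact coloring_r3 a b c p q r t hab hac hbc htop hmid hbot h

/-- The number of colourings of a virtual link by a group. -/
noncomputable def coloringNumber (G : Type*) [Group G] : VirtualLink μ → ℕ :=
  Quot.lift (fun D => Nat.card (Coloring G D.word)) fun _ _ h =>
    Nat.card_congr (coloring_move h).some

end Invariance

end VirtualLinks

namespace VirtualLinks

/-! ### Splicing words of arrows into a circle. -/

section Splice

variable {α : Type*} {μ : ℕ}

/-- An arrow whose tail lies on the arc `letter` and whose head lies in the block of heads that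
ends the arc `block`. The sign is positive if `pos` holds. -/
structure Arrow (α : Type*) where
  label : ℕ
  block : α
  letter : α
  pos : Bool

/-- The unit with the given positivity. -/
def unitOf (b : Bool) : ℤˣ := if b then 1 else -1

theorem unitOf_not (b : Bool) : unitOf (!b) = -unitOf b := by cases b <;> simp [unitOf]

namespace Arrow

/-- The tail of an arrow. -/
def tail (o : Arrow α) : Endpoint := ⟨o.label, true, unitOf o.pos⟩

/-- The head of an arrow. -/
def head (o : Arrow α) : Endpoint := ⟨o.label, false, unitOf o.pos⟩

/-- The signed generator of the free group that an arrow stands for. -/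
def symbol (o : Arrow α) : (α × α) × Bool := ((o.block, o.letter), o.pos)

end Arrow

/-- The conditions under which arrows can be added to a diagram. -/
structure Admissible (D : GaussDiagram μ) (arcs : List α) (occ : List (Arrow α)) : Prop where
  arcs_nodup : arcs.Nodup
  label_nodup : (occ.map Arrow.label).Nodup
  block_mem : ∀ o ∈ occ, o.block ∈ arcs
  letter_mem : ∀ o ∈ occ, o.letter ∈ arcs
  fresh : ∀ o ∈ occ, ∀ i, ∀ e ∈ D.word i, e.chord ≠ o.label

theorem Admissible.sublist {D : GaussDiagram μ} {arcs : List α} {occ occ' : List (Arrow α)}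
    (h : Admissible D arcs occ) (hs : occ'.Sublist occ) : Admissible D arcs occ' where
  arcs_nodup := h.arcs_nodup
  label_nodup := h.label_nodup.sublist (hs.map _)
  block_mem o ho := h.block_mem o (hs.subset ho)
  letter_mem o ho := h.letter_mem o (hs.subset ho)
  fresh o ho := h.fresh o (hs.subset ho)

theorem Admissible.perm {D : GaussDiagram μ} {arcs : List α} {occ occ' : List (Arrow α)}
    (h : Admissible D arcs occ) (hs : occ'.Perm occ) : Admissible D arcs occ' where
  arcs_nodup := h.arcs_nodup
  label_nodup := (hs.map _).nodup_iff.2 h.label_nodup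
  block_mem o ho := h.block_mem o (hs.subset ho)
  letter_mem o ho := h.letter_mem o (hs.subset ho)
  fresh o ho := h.fresh o (hs.subset ho)

variable [DecidableEq α]

/-- The part of a circle that consists of the given arcs: each arc carries the tails of the arrows
that have it as their letter, followed by the heads of the arrows in its block. -/
def realize (arcs : List α) (occ : List (Arrow α)) : List Endpoint :=
  arcs.flatMap fun k => (occ.filter fun o => o.letter = k).map Arrow.tail ++
    (occ.filter fun o => o.block = k).map Arrow.head

theorem realize_nil (arcs : List α) : realize arcs [] = [] := by
  simp [realize]

theorem realize_append_arcs (a a' : List α) (occ : List (Arrow α)) :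
    realize (a ++ a') occ = realize a occ ++ realize a' occ := by
  simp [realize]

theorem mem_realize {arcs : List α} {occ : List (Arrow α)} {e : Endpoint} :
    e ∈ realize arcs occ ↔ ∃ o ∈ occ, (o.letter ∈ arcs ∧ e = o.tail) ∨
      (o.block ∈ arcs ∧ e = o.head) := by
  simp only [realize, List.mem_flatMap, List.mem_append, List.mem_map, List.mem_filter,
    decide_eq_true_eq]
  constructor
  · rintro ⟨k, hk, ⟨o, ⟨ho, rfl⟩, rfl⟩ | ⟨o, ⟨ho, rfl⟩, rfl⟩⟩
    · exact ⟨o, ho, Or.inl ⟨hk, rfl⟩⟩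
    · exact ⟨o, ho, Or.inr ⟨hk, rfl⟩⟩
  · rintro ⟨o, ho, ⟨hk, rfl⟩ | ⟨hk, rfl⟩⟩
    · exact ⟨o.letter, hk, Or.inl ⟨o, ⟨ho, rfl⟩, rfl⟩⟩
    · exact ⟨o.block, hk, Or.inr ⟨o, ⟨ho, rfl⟩, rfl⟩⟩

theorem realize_filter (arcs : List α) (occ : List (Arrow α)) (p : ℕ → Bool) :
    (realize arcs occ).filter (fun e => p e.chord) =
      realize arcs (occ.filter fun o => p o.label) := by
  simp only [realize, List.filter_flatMap, List.filter_append, List.filter_map, List.filter_filter]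
  congr! 4
  · exact List.filter_congr fun o _ => by simp [Arrow.tail, Bool.and_comm]
  · exact List.filter_congr fun o _ => by simp [Arrow.head, Bool.and_comm]

/-- The label of an endpoint's chord together with the kind of the endpoint. -/
def Endpoint.key (e : Endpoint) : ℕ × Bool := (e.chord, e.isOver)

theorem nodup_keys_realize {arcs : List α} {occ : List (Arrow α)} (ha : arcs.Nodup)
    (hl : (occ.map Arrow.label).Nodup) : ((realize arcs occ).map Endpoint.key).Nodup := by
  have hinj := List.inj_on_of_nodup_map hl
  have htail : ∀ o : Arrow α, o.tail.key = (o.label, true) := fun _ => rfl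
  have hhead : ∀ o : Arrow α, o.head.key = (o.label, false) := fun _ => rfl
  rw [realize, List.map_flatMap, List.nodup_flatMap]
  constructor
  · intro k _
    rw [List.map_append, List.map_map, List.map_map, List.nodup_append]
    refine ⟨?_, ?_, ?_⟩
    · refine List.Nodup.of_map Prod.fst ?_
      rw [List.map_map]
      exact hl.sublist (List.filter_sublist.map _)
    · refine List.Nodup.of_map Prod.fst ?_
      rw [List.map_map]
      exact hl.sublist (List.filter_sublist.map _)
    · simp only [List.mem_map, Function.comp_apply]
      rintro _ ⟨o, -, rfl⟩ _ ⟨o', -, rfl⟩ h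
      simp [htail, hhead] at h
  · refine ha.pairwise_of_forall_ne fun k _ k' _ hne => ?_
    rintro x h1 h2
    simp only [List.map_append, List.map_map, List.mem_append, List.mem_map, List.mem_filter,
      decide_eq_true_eq, Function.comp_apply] at h1 h2
    rcases h1 with ⟨o, ⟨ho, hk⟩, rfl⟩ | ⟨o, ⟨ho, hk⟩, rfl⟩ <;>
    rcases h2 with ⟨o', ⟨ho', hk'⟩, h⟩ | ⟨o', ⟨ho', hk'⟩, h⟩ <;>
    simp [htail, hhead] at h
    · obtain rfl := hinj ho' ho h
      exact hne (hk.symm.trans hk')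
    · obtain rfl := hinj ho' ho h
      exact hne (hk.symm.trans hk')

theorem flatten_ofFn_update_perm (w : Fin μ → List Endpoint) (i : Fin μ) (r : List Endpoint) :
    (List.ofFn (Function.update w i (w i ++ r))).flatten.Perm ((List.ofFn w).flatten ++ r) := by
  classical
  refine List.perm_iff_count.2 fun e => ?_
  simp only [List.count_flatten, List.map_ofFn, List.sum_ofFn, List.count_append,
    Function.comp_apply]
  have : ∀ j, List.count e (Function.update w i (w i ++ r) j) =
      List.count e (w j) + if j = i then List.count e r else 0 := by
    intro j
    by_cases hj : j = i
    · subst hj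
      simp
    · simp [hj]
  simp [this, Finset.sum_add_distrib]

/-- The arrows `occ` on the new arcs `arcs` are inserted at the end of the `i`-th circle. -/
def splice (D : GaussDiagram μ) (i : Fin μ) (arcs : List α) (occ : List (Arrow α))
    (h : Admissible D arcs occ) : GaussDiagram μ where
  word := Function.update D.word i (D.word i ++ realize arcs occ)
  nodup := by
    refine ((flatten_ofFn_update_perm _ _ _).map _).nodup_iff.2 ?_
    rw [List.map_append, List.nodup_append]
    refine ⟨D.nodup, nodup_keys_realize h.arcs_nodup h.label_nodup, ?_⟩
    intro x hx y hy hxy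
    subst hxy
    obtain ⟨e, he, rfl⟩ := List.mem_map.1 hx
    obtain ⟨e', he', hee⟩ := List.mem_map.1 hy
    obtain ⟨w, hw, hew⟩ := List.mem_flatten.1 he
    obtain ⟨j, rfl⟩ := (List.mem_ofFn' _ _).1 hw
    have hch : e'.chord = e.chord := (Prod.ext_iff.1 hee).1
    obtain ⟨o, ho, ⟨-, rfl⟩ | ⟨-, rfl⟩⟩ := mem_realize.1 he'
    · exact h.fresh o ho j e hew hch.symm
    · exact h.fresh o ho j e hew hch.symm
  paired := by
    have hsub : ∀ j, ∀ e ∈ D.word j,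
        e ∈ Function.update D.word i (D.word i ++ realize arcs occ) j := by
      intro j e he
      by_cases hj : j = i
      · subst hj
        simp [he]
      · simpa [hj] using he
    intro j e he
    by_cases hj : j = i
    · subst hj
      rw [Function.update_self, List.mem_append] at he
      rcases he with he | he
      · exact (D.paired j e he).imp fun k hk => hsub k _ hk
      · refine ⟨j, ?_⟩
        rw [Function.update_self, List.mem_append]
        obtain ⟨o, ho, ⟨-, rfl⟩ | ⟨-, rfl⟩⟩ := mem_realize.1 he
        · exact Or.inr (mem_realize.2 ⟨o, ho, Or.inr ⟨h.block_mem o ho, rfl⟩⟩)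
        · exact Or.inr (mem_realize.2 ⟨o, ho, Or.inl ⟨h.letter_mem o ho, rfl⟩⟩)
    · rw [Function.update_of_ne hj] at he
      exact (D.paired j e he).imp fun k hk => hsub k _ hk

theorem splice_word (D : GaussDiagram μ) (i : Fin μ) (arcs : List α) (occ : List (Arrow α))
    (h : Admissible D arcs occ) :
    (splice D i arcs occ h).word = Function.update D.word i (D.word i ++ realize arcs occ) := rfl

theorem gaussDiagram_ext {D D' : GaussDiagram μ} (h : ∀ i, D.word i = D'.word i) : D = D' := by
  cases D
  cases D'
  congr
  exact funext h

theorem splice_nil (D : GaussDiagram μ) (i : Fin μ) (arcs : List α)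
    (h : Admissible D arcs []) : splice D i arcs [] h = D :=
  gaussDiagram_ext fun j => by simp [splice_word, realize_nil]

theorem splice_follows {D : GaussDiagram μ} {i : Fin μ} {arcs : List α} {occ : List (Arrow α)}
    (h : Admissible D arcs occ) {x y : Endpoint} (hxy : [x, y] <:+: realize arcs occ) :
    (splice D i arcs occ h).Follows x y := by
  obtain ⟨u, v, huv⟩ := hxy
  refine ⟨i, v ++ (D.word i ++ u), ?_⟩
  rw [splice_word, Function.update_self, ← huv]
  have := List.isRotated_append (l := D.word i ++ u) (l' := [x, y] ++ v)
  simpa using this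

theorem infix_realize_tail {arcs : List α} {u v : List (Arrow α)} {o o' : Arrow α}
    (h : o.letter ∈ arcs) (ho : o'.letter = o.letter) :
    [o.tail, o'.tail] <:+: realize arcs (u ++ o :: o' :: v) := by
  obtain ⟨A, B, rfl⟩ := List.append_of_mem h
  refine ⟨realize A (u ++ o :: o' :: v) ++
    (u.filter fun p => p.letter = o.letter).map Arrow.tail, (v.filter fun p =>
    p.letter = o.letter).map Arrow.tail ++ ((u ++ o :: o' :: v).filter fun p =>
    p.block = o.letter).map Arrow.head ++ realize B (u ++ o :: o' :: v), ?_⟩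
  simp [realize, ho]

theorem infix_realize_head {arcs : List α} {u v : List (Arrow α)} {o o' : Arrow α}
    (h : o.block ∈ arcs) (ho : o'.block = o.block) :
    [o.head, o'.head] <:+: realize arcs (u ++ o :: o' :: v) := by
  obtain ⟨A, B, rfl⟩ := List.append_of_mem h
  refine ⟨realize A (u ++ o :: o' :: v) ++
    ((u ++ o :: o' :: v).filter fun p => p.letter = o.block).map Arrow.tail ++
    (u.filter fun p => p.block = o.block).map Arrow.head, (v.filter fun p =>
    p.block = o.block).map Arrow.head ++ realize B (u ++ o :: o' :: v), ?_⟩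
  simp [realize, ho]

/-- Being consecutive in the list, the two arrows have neighbouring tails on their common letter and
neighbouring heads in their common block; opposite signs then allow a second Reidemeister move. -/
theorem splice_link_cancel {D : GaussDiagram μ} {i : Fin μ} {arcs : List α}
    {u v : List (Arrow α)} {o o' : Arrow α} (h : Admissible D arcs (u ++ o :: o' :: v))
    (h' : Admissible D arcs (u ++ v)) (hb : o'.block = o.block) (hl : o'.letter = o.letter)
    (hp : o'.pos = !o.pos) :
    (splice D i arcs (u ++ o :: o' :: v) h).link = (splice D i arcs (u ++ v) h').link := by
  have hnd := h.label_nodup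
  have hs : unitOf o'.pos = -unitOf o.pos := by rw [hp, unitOf_not]
  have ht : o'.tail = ⟨o'.label, true, -unitOf o.pos⟩ := by rw [Arrow.tail, hs]
  have hh : o'.head = ⟨o'.label, false, -unitOf o.pos⟩ := by rw [Arrow.head, hs]
  have hmo : o ∈ u ++ o :: o' :: v := by simp
  have hmo' : o' ∈ u ++ o :: o' :: v := by simp
  have hperm : (u ++ o :: o' :: v).Perm (o :: o' :: (u ++ v)) := by
    refine List.perm_middle.trans (List.Perm.cons _ List.perm_middle)
  have hnd2 := (hperm.map Arrow.label).nodup_iff.1 hnd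
  simp only [List.map_cons, List.nodup_cons, List.mem_cons, not_or] at hnd2
  refine Quot.sound (GaussDiagram.Move.r2 _ _ o.label o'.label (unitOf o.pos) 1 1 hnd2.1.1
    (Or.inl ⟨rfl, ?_⟩) (Or.inl ⟨rfl, ?_⟩) ?_)
  · rw [← ht]
    exact splice_follows h (infix_realize_tail (h.letter_mem o hmo) hl)
  · rw [← hh]
    exact splice_follows h (infix_realize_head (h.block_mem o hmo) hb)
  · have hD : ∀ j, (D.word j).filter (fun e => e.chord ∉ ({o.label, o'.label} : Finset ℕ)) =
        D.word j := fun j => List.filter_eq_self.2 fun e he => by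
      simpa using ⟨h.fresh o hmo j e he, h.fresh o' hmo' j e he⟩
    have hocc : (u ++ o :: o' :: v).filter
        (fun p => p.label ∉ ({o.label, o'.label} : Finset ℕ)) = u ++ v := by
      have hmem : ∀ p ∈ u ++ v, p.label ≠ o.label ∧ p.label ≠ o'.label := fun p hp =>
        ⟨fun h => hnd2.1.2 (h ▸ List.mem_map_of_mem hp),
          fun h => hnd2.2.1 (h ▸ List.mem_map_of_mem hp)⟩
      have h1 : (u ++ v).filter
          (fun p => p.label ∉ ({o.label, o'.label} : Finset ℕ)) = u ++ v :=
        List.filter_eq_self.2 fun p hp => by simpa using hmem p hp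
      rw [List.filter_append] at h1 ⊢
      rw [List.filter_cons_of_neg (by simp), List.filter_cons_of_neg (by simp), h1]
    intro j
    by_cases hj : j = i
    · subst hj
      simp only [splice_word, Function.update_self]
      rw [List.filter_append, hD,
        realize_filter arcs _ (fun a => decide (a ∉ ({o.label, o'.label} : Finset ℕ))), hocc]
    · simp only [splice_word, Function.update_of_ne hj, hD]

/-- Each cancellation step of the free group is lifted to a cancellation of two arrows; the labels
of the remaining arrows stay as they are. -/
theorem splice_link_of_red {D : GaussDiagram μ} {i : Fin μ} {arcs : List α}
    {L : List ((α × α) × Bool)} {occ : List (Arrow α)} (h : Admissible D arcs occ)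
    (hL : occ.map Arrow.symbol = L) (hred : FreeGroup.Red L []) :
    (splice D i arcs occ h).link = D.link := by
  induction hred using Relation.ReflTransGen.head_induction_on generalizing occ with
  | refl =>
    obtain rfl := List.map_eq_nil_iff.1 hL
    rw [splice_nil]
  | head hstep _ ih =>
    cases hstep with
    | @not L₁ L₂ x b =>
      obtain ⟨u, w, rfl, rfl, hw⟩ := List.map_eq_append_iff.1 hL
      obtain ⟨o, w', rfl, ho, hw'⟩ := List.map_eq_cons_iff.1 hw
      obtain ⟨o', v, rfl, ho', rfl⟩ := List.map_eq_cons_iff.1 hw'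
      have hadm : Admissible D arcs (u ++ v) :=
        h.sublist ((List.Sublist.refl u).append
          ((List.sublist_cons_self _ _).trans (List.sublist_cons_self _ _)))
      rw [← ih hadm (by simp)]
      simp only [Arrow.symbol] at ho ho'
      cases ho
      simp only [Prod.mk.injEq] at ho'
      exact splice_link_cancel h hadm ho'.1.1 ho'.1.2 ho'.2

/-- The value of a list of arrows under an assignment of group elements to pairs of a block and a
letter. -/
def arrowValue {H : Type*} [Group H] (φ : α × α → H) (occ : List (Arrow α)) : H :=
  (occ.map fun o => cond o.pos (φ (o.block, o.letter)) (φ (o.block, o.letter))⁻¹).prod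

theorem splice_link_of_value_eq_one {D : GaussDiagram μ} {i : Fin μ} {arcs : List α}
    {occ : List (Arrow α)} (h : Admissible D arcs occ)
    (h1 : arrowValue (FreeGroup.of : α × α → FreeGroup (α × α)) occ = 1) :
    (splice D i arcs occ h).link = D.link := by
  refine splice_link_of_red h rfl ?_
  have h2 : FreeGroup.mk (occ.map Arrow.symbol) = 1 := by
    -- The lift of the generators is the identity; rewriting by it turns the class of the word into
    -- the product that `arrowValue` computes.
    have h3 : FreeGroup.lift FreeGroup.of (FreeGroup.mk (occ.map Arrow.symbol)) =
        FreeGroup.mk (occ.map Arrow.symbol) := by simp [FreeGroup.lift_of_eq_id]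
    rw [← h1, ← h3, FreeGroup.lift_mk, List.map_map]
    rfl
  have h3 := (FreeGroup.reduce.red : FreeGroup.Red (occ.map Arrow.symbol) _)
  rwa [← FreeGroup.toWord_mk, h2, FreeGroup.toWord_one] at h3

end Splice

end VirtualLinks

namespace VirtualLinks

/-! ### Commutator gadgets and the forbidden moves at them. -/

section Gadget

variable {α : Type*} {μ : ℕ}

/-- A commutator of two letters in a block of heads; the index is that of the family of triangles
its first two heads belong to. -/
structure Gadget (α : Type*) where
  block : α
  index : ℕ
  left : α
  right : α

namespace Gadget

/-- The gadget that represents the inverse commutator. -/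
def inv (γ : Gadget α) : Gadget α := ⟨γ.block, γ.index, γ.right, γ.left⟩

/-- The first arrow of the gadget with number `q`. -/
def first (γ : Gadget α) (q : ℕ) : Arrow α := ⟨4 * q, γ.block, γ.left, true⟩

/-- The second arrow of the gadget with number `q`. -/
def second (γ : Gadget α) (q : ℕ) : Arrow α := ⟨4 * q + 1, γ.block, γ.right, true⟩

/-- The last two arrows of the gadget with number `q`. -/
def rest (γ : Gadget α) (q : ℕ) : List (Arrow α) :=
  [⟨4 * q + 2, γ.block, γ.left, false⟩, ⟨4 * q + 3, γ.block, γ.right, false⟩]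

open Classical in
/-- The arrows of a gadget, the first two being exchanged if its index lies in `T`. -/
noncomputable def expand (T : Set ℕ) (p : Gadget α × ℕ) : List (Arrow α) :=
  if p.1.index ∈ T then p.1.second p.2 :: p.1.first p.2 :: p.1.rest p.2
  else p.1.first p.2 :: p.1.second p.2 :: p.1.rest p.2

open Classical in
/-- The value of a gadget if the gadgets with index in `T` are made trivial. -/
noncomputable def value {H : Type*} [Group H] (T : Set ℕ) (φ : α × α → H) (γ : Gadget α) : H :=
  if γ.index ∈ T then 1 else φ (γ.block, γ.left) * φ (γ.block, γ.right) *
    (φ (γ.block, γ.left))⁻¹ * (φ (γ.block, γ.right))⁻¹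

end Gadget

/-- The arrows of a list of gadgets, numbered from `B` on. -/
noncomputable def occurrences (T : Set ℕ) (P : List (Gadget α)) (B : ℕ) : List (Arrow α) :=
  (P.zipIdx B).flatMap (Gadget.expand T)

theorem occurrences_append (T : Set ℕ) (P Q : List (Gadget α)) (B : ℕ) :
    occurrences T (P ++ Q) B = occurrences T P B ++ occurrences T Q (B + P.length) := by
  simp [occurrences, List.zipIdx_append]

theorem expand_empty (p : Gadget α × ℕ) :
    Gadget.expand ∅ p = p.1.first p.2 :: p.1.second p.2 :: p.1.rest p.2 := by
  simp [Gadget.expand]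

theorem expand_perm (T : Set ℕ) (p : Gadget α × ℕ) :
    (Gadget.expand T p).Perm (Gadget.expand ∅ p) := by
  rw [expand_empty, Gadget.expand]
  split_ifs
  · exact List.Perm.swap _ _ _
  · exact List.Perm.refl _

theorem occurrences_perm (T : Set ℕ) (P : List (Gadget α)) (B : ℕ) :
    (occurrences T P B).Perm (occurrences ∅ P B) :=
  List.Perm.flatMap_left _ fun p _ => expand_perm T p

theorem mem_occurrences {P : List (Gadget α)} {B : ℕ} {o : Arrow α} :
    o ∈ occurrences ∅ P B ↔ ∃ p ∈ P.zipIdx B,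
      o = p.1.first p.2 ∨ o = p.1.second p.2 ∨ o ∈ p.1.rest p.2 := by
  simp [occurrences, expand_empty]

theorem occurrences_labels (P : List (Gadget α)) (B : ℕ) :
    (occurrences ∅ P B).map Arrow.label = List.range' (4 * B) (4 * P.length) := by
  induction P generalizing B with
  | nil => simp [occurrences]
  | cons γ P ih =>
    have : occurrences ∅ (γ :: P) B =
        (γ.first B :: γ.second B :: γ.rest B) ++ occurrences ∅ P (B + 1) := by
      simp [occurrences, expand_empty]
    rw [this, List.map_append, ih, List.length_cons, mul_add, mul_one, mul_add, mul_one,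
      add_comm (4 * P.length), ← List.range'_append_1]
    simp [Gadget.first, Gadget.second, Gadget.rest, List.range']

theorem arrowValue_occurrences {H : Type*} [Group H] (T : Set ℕ) (φ : α × α → H)
    (P : List (Gadget α)) (B : ℕ) :
    arrowValue φ (occurrences T P B) = (P.map (Gadget.value T φ)).prod := by
  induction P generalizing B with
  | nil => simp [occurrences, arrowValue]
  | cons γ P ih =>
    have h1 : occurrences T (γ :: P) B = Gadget.expand T (γ, B) ++ occurrences T P (B + 1) := by
      simp [occurrences]
    have h2 : ∀ u v : List (Arrow α), arrowValue φ (u ++ v) = arrowValue φ u * arrowValue φ v :=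
      fun u v => by simp [arrowValue]
    rw [h1, h2, ih, List.map_cons, List.prod_cons]
    congr 1
    by_cases h : γ.index ∈ T <;>
      simp [arrowValue, Gadget.expand, Gadget.value, h, Gadget.first, Gadget.second, Gadget.rest,
        mul_assoc]

/-- The conditions under which gadgets can be added to a diagram. -/
structure GadgetsFit (D : GaussDiagram μ) (arcs : List α) (P : List (Gadget α)) (B : ℕ) :
    Prop where
  arcs_nodup : arcs.Nodup
  block_mem : ∀ γ ∈ P, γ.block ∈ arcs
  left_mem : ∀ γ ∈ P, γ.left ∈ arcs
  right_mem : ∀ γ ∈ P, γ.right ∈ arcs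
  left_ne_right : ∀ γ ∈ P, γ.left ≠ γ.right
  fresh : ∀ i, ∀ e ∈ D.word i, e.chord < 4 * B

theorem GadgetsFit.admissible {D : GaussDiagram μ} {arcs : List α} {P : List (Gadget α)} {B : ℕ}
    (h : GadgetsFit D arcs P B) (T : Set ℕ) : Admissible D arcs (occurrences T P B) := by
  refine Admissible.perm (occ := occurrences ∅ P B) ⟨h.arcs_nodup, ?_, ?_, ?_, ?_⟩
    (occurrences_perm T P B)
  · rw [occurrences_labels]
    exact List.nodup_range'
  · intro o ho
    obtain ⟨p, hp, ho⟩ := mem_occurrences.1 ho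
    have := h.block_mem _ (List.fst_mem_of_mem_zipIdx hp)
    simp only [Gadget.first, Gadget.second, Gadget.rest, List.mem_cons, List.not_mem_nil,
      or_false] at ho
    rcases ho with rfl | rfl | rfl | rfl <;> exact this
  · intro o ho
    obtain ⟨p, hp, ho⟩ := mem_occurrences.1 ho
    have h1 := h.left_mem _ (List.fst_mem_of_mem_zipIdx hp)
    have h2 := h.right_mem _ (List.fst_mem_of_mem_zipIdx hp)
    simp only [Gadget.first, Gadget.second, Gadget.rest, List.mem_cons, List.not_mem_nil,
      or_false] at ho
    rcases ho with rfl | rfl | rfl | rfl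
    exacts [h1, h2, h1, h2]
  · intro o ho i e he hc
    have h1 : o.label ∈ (occurrences ∅ P B).map Arrow.label := List.mem_map_of_mem ho
    rw [occurrences_labels, List.mem_range'_1] at h1
    have := h.fresh i e he
    omega

/-- Disjointness makes all endpoints of the triangles distinct, so the transpositions do not
interfere with each other. -/
theorem exists_exchange {S : Set (Endpoint × Endpoint)}
    (hS : ∀ d ∈ S, ∀ e ∈ S, d ≠ e → GaussDiagram.TrianglesDisjoint d e)
    (hne : ∀ d ∈ S, d.1.chord ≠ d.2.chord) :
    ∃ f : Endpoint → Endpoint, (∀ d ∈ S, f d.1 = d.2 ∧ f d.2 = d.1) ∧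
      ∀ e, (∀ d ∈ S, e ≠ d.1 ∧ e ≠ d.2) → f e = e := by
  classical
  have h11 : ∀ d ∈ S, ∀ e ∈ S, d.1 = e.1 → d = e := fun d hd e he h => by
    by_contra hde
    exact (hS d hd e he hde).1 (congrArg _ h)
  have h22 : ∀ d ∈ S, ∀ e ∈ S, d.2 = e.2 → d = e := fun d hd e he h => by
    by_contra hde
    exact (hS d hd e he hde).2.2.2 (congrArg _ h)
  have h21 : ∀ d ∈ S, ∀ e ∈ S, d.2 ≠ e.1 := fun d hd e he h => by
    by_cases hde : d = e
    · subst hde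
      exact hne d hd (congrArg _ h.symm)
    · exact (hS d hd e he hde).2.2.1 (congrArg _ h)
  refine ⟨fun e => if h : ∃ d ∈ S, d.1 = e then h.choose.2 else
    if h : ∃ d ∈ S, d.2 = e then h.choose.1 else e, fun d hd => ⟨?_, ?_⟩, fun e he => ?_⟩
  · have h : ∃ d' ∈ S, d'.1 = d.1 := ⟨d, hd, rfl⟩
    simp only [dif_pos h]
    rw [h11 _ h.choose_spec.1 d hd h.choose_spec.2]
  · have h0 : ¬ ∃ d' ∈ S, d'.1 = d.2 := fun ⟨d', hd', h⟩ => h21 d hd d' hd' h.symm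
    have h : ∃ d' ∈ S, d'.2 = d.2 := ⟨d, hd, rfl⟩
    simp only [dif_neg h0, dif_pos h]
    rw [h22 _ h.choose_spec.1 d hd h.choose_spec.2]
  · have h1 : ¬ ∃ d' ∈ S, d'.1 = e := fun ⟨d', hd', h⟩ => (he d' hd').1 h.symm
    have h2 : ¬ ∃ d' ∈ S, d'.2 = e := fun ⟨d', hd', h⟩ => (he d' hd').2 h.symm
    simp only [dif_neg h1, dif_neg h2]

/-- The triangles formed by the first two heads of the gadgets with index in `T`. -/
def gadgetTriangles (T : Set ℕ) (P : List (Gadget α)) (B : ℕ) : Set (Endpoint × Endpoint) :=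
  {d | ∃ p ∈ P.zipIdx B, p.1.index ∈ T ∧ d = ((p.1.first p.2).head, (p.1.second p.2).head)}

theorem zipIdx_eq_of_snd {P : List (Gadget α)} {B : ℕ} {p p' : Gadget α × ℕ}
    (hp : p ∈ P.zipIdx B) (hp' : p' ∈ P.zipIdx B) (h : p.2 = p'.2) : p = p' :=
  List.inj_on_of_nodup_map (f := Prod.snd) (by rw [List.zipIdx_map_snd]; exact List.nodup_range')
    hp hp' h

theorem gadgetTriangles_disjoint {T : Set ℕ} {P : List (Gadget α)} {B : ℕ}
    {d e : Endpoint × Endpoint} (hd : d ∈ gadgetTriangles T P B)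
    (he : e ∈ gadgetTriangles T P B) (hde : d ≠ e) : GaussDiagram.TrianglesDisjoint d e := by
  obtain ⟨p, hp, -, rfl⟩ := hd
  obtain ⟨p', hp', -, rfl⟩ := he
  have : p.2 ≠ p'.2 := fun h => hde (by rw [zipIdx_eq_of_snd hp hp' h])
  simp only [GaussDiagram.TrianglesDisjoint, Arrow.head, Gadget.first, Gadget.second]
  omega

variable [DecidableEq α]

/-- A forbidden move exchanges heads only, whereas exchanging two arrows in the list could also
exchange their tails. The effect is the same because the two letters of a gadget differ, so that the
tails lie on different arcs. -/
theorem map_realize_occurrences {f : Endpoint → Endpoint} {T : Set ℕ} {P : List (Gadget α)}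
    {B : ℕ} (arcs : List α) (hP : ∀ γ ∈ P, γ.left ≠ γ.right)
    (hf : ∀ d ∈ gadgetTriangles T P B, f d.1 = d.2 ∧ f d.2 = d.1)
    (hf' : ∀ e, (∀ d ∈ gadgetTriangles T P B, e ≠ d.1 ∧ e ≠ d.2) → f e = e) :
    (realize arcs (occurrences ∅ P B)).map f = realize arcs (occurrences T P B) := by
  have htail : ∀ o : Arrow α, f o.tail = o.tail := fun o => hf' _ fun d hd => by
    obtain ⟨p, hp, -, rfl⟩ := hd
    constructor <;> exact fun h => by cases congrArg Endpoint.isOver h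
  have hrest : ∀ p ∈ P.zipIdx B, ∀ o ∈ p.1.rest p.2, f o.head = o.head := by
    intro p hp o ho
    refine hf' _ fun d hd => ?_
    obtain ⟨p', hp', -, rfl⟩ := hd
    constructor <;> intro h
    all_goals
      have h := congrArg Endpoint.chord h
      simp only [Gadget.rest, List.mem_cons, List.not_mem_nil, or_false] at ho
      rcases ho with rfl | rfl <;> simp only [Arrow.head, Gadget.first, Gadget.second] at h <;>
        omega
  have hfix : ∀ p ∈ P.zipIdx B, p.1.index ∉ T →
      f (p.1.first p.2).head = (p.1.first p.2).head ∧
      f (p.1.second p.2).head = (p.1.second p.2).head := by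
    intro p hp hpT
    constructor <;>
    · refine hf' _ fun d hd => ?_
      obtain ⟨p', hp', hT, rfl⟩ := hd
      constructor <;> intro h <;>
      · have h := congrArg Endpoint.chord h
        simp only [Arrow.head, Gadget.first, Gadget.second] at h
        have : p = p' := zipIdx_eq_of_snd hp hp' (by omega)
        exact hpT (this ▸ hT)
  simp only [realize, List.map_flatMap, List.map_append, List.map_map]
  refine List.flatMap_congr fun k _ => ?_
  congr 1
  · have : f ∘ Arrow.tail = (Arrow.tail : Arrow α → Endpoint) := funext htail
    rw [this, occurrences, occurrences, List.filter_flatMap, List.filter_flatMap]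
    congr 1
    refine List.flatMap_congr fun p hp => ?_
    rw [expand_empty, Gadget.expand]
    split_ifs
    -- At most one of the two exchanged arrows has its tail on the arc `k`, so their order is
    -- invisible there.
    · have := hP _ (List.fst_mem_of_mem_zipIdx hp)
      by_cases h1 : p.1.left = k <;> by_cases h2 : p.1.right = k <;>
        simp [Gadget.first, Gadget.second, h1, h2]
      exact this (h1.trans h2.symm)
    · rfl
  · rw [occurrences, occurrences, List.filter_flatMap, List.filter_flatMap, List.map_flatMap,
      List.map_flatMap]
    refine List.flatMap_congr fun p hp => ?_
    have hr : (p.1.rest p.2).map (f ∘ Arrow.head) = (p.1.rest p.2).map Arrow.head :=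
      List.map_congr_left fun o ho => hrest p hp o ho
    have hblock : ∀ T, ∀ o ∈ Gadget.expand T p, o.block = p.1.block := by
      intro T o ho
      rw [(expand_perm T p).mem_iff, expand_empty] at ho
      simp only [Gadget.first, Gadget.second, Gadget.rest, List.mem_cons, List.not_mem_nil,
        or_false] at ho
      rcases ho with rfl | rfl | rfl | rfl <;> rfl
    by_cases hk : p.1.block = k
    · rw [List.filter_eq_self.2 fun o ho => by simp [hblock _ o ho, hk],
        List.filter_eq_self.2 fun o ho => by simp [hblock _ o ho, hk], expand_empty,
        Gadget.expand]
      split_ifs with hT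
      · have := hf _ ⟨p, hp, hT, rfl⟩
        simp only [List.map_cons, hr, Function.comp_apply, this]
      · have := hfix p hp hT
        simp only [List.map_cons, hr, Function.comp_apply, this]
    · rw [List.filter_eq_nil_iff.2 fun o ho => by simp [hblock _ o ho, hk],
        List.filter_eq_nil_iff.2 fun o ho => by simp [hblock _ o ho, hk]]
      rfl

/-- Forbidden moves at a subfamily of triangles turn its gadgets into words of value 1. By `htriv`
the whole list then has value 1 in the free group, and all the new arrows can be removed. -/
theorem fSimilar_splice {D : GaussDiagram μ} (i : Fin μ) {arcs : List α} {P : List (Gadget α)}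
    {B n : ℕ} (h : GadgetsFit D arcs P B) (hindex : ∀ k < n, ∃ γ ∈ P, γ.index = k)
    (htriv : ∀ T : Set ℕ, (∃ k < n, k ∈ T) →
      (P.map (Gadget.value T (FreeGroup.of : α × α → FreeGroup (α × α)))).prod = 1) :
    FSimilar n (splice D i arcs (occurrences ∅ P B) (h.admissible ∅)).link D.link := by
  refine ⟨_, fun k => gadgetTriangles {(k : ℕ)} P B, rfl, fun k => ?_, fun k d hd => ?_,
    fun k l d hd e he hne => ?_, fun T hT => ?_⟩
  · obtain ⟨γ, hγ, hk⟩ := hindex k k.2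
    obtain ⟨q, hq, rfl⟩ := List.mem_iff_getElem.1 hγ
    exact ⟨_, (P[q], B + q), List.mk_add_mem_zipIdx_iff_getElem?.2 (List.getElem?_eq_getElem hq), hk, rfl⟩
  · obtain ⟨p, hp, -, rfl⟩ := hd
    obtain ⟨u, v, huv⟩ := List.append_of_mem hp
    refine ⟨splice_follows _ ?_, rfl⟩
    have : occurrences ∅ P B = u.flatMap (Gadget.expand ∅) ++ p.1.first p.2 :: p.1.second p.2 ::
        (p.1.rest p.2 ++ v.flatMap (Gadget.expand ∅)) := by
      rw [occurrences, huv]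
      simp [expand_empty]
    rw [this]
    exact infix_realize_head (h.block_mem _ (List.fst_mem_of_mem_zipIdx hp)) rfl
  -- All families lie in the set of triangles of all gadgets. A triangle determines its gadget
  -- through the label of its first head, hence also its index, so different families share no
  -- triangle.
  · have hsub : ∀ m : Fin n, gadgetTriangles {(m : ℕ)} P B ⊆ gadgetTriangles Set.univ P B :=
      fun m d ⟨p, hp, _, h⟩ => ⟨p, hp, trivial, h⟩
    refine gadgetTriangles_disjoint (hsub k hd) (hsub l he) fun hde => hne ?_
    subst hde
    obtain ⟨p, hp, hk, rfl⟩ := hd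
    obtain ⟨p', hp', hl, h⟩ := he
    have h2 := congrArg Endpoint.chord (Prod.ext_iff.1 h).1
    simp only [Arrow.head, Gadget.first] at h2
    obtain rfl := zipIdx_eq_of_snd hp hp' (by omega)
    have hkl : k = l := Fin.ext (Eq.trans (Eq.symm hk) hl)
    rw [hkl]
  · set S : Set ℕ := Fin.val '' T with hS
    have hU : (⋃ k ∈ T, gadgetTriangles {(k : ℕ)} P B) = gadgetTriangles S P B := by
      ext d
      simp only [Set.mem_iUnion, gadgetTriangles, Set.mem_ofPred_eq, Set.mem_singleton_iff, hS,
        Set.mem_image]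
      constructor
      · rintro ⟨k, hk, p, hp, hpk, rfl⟩
        exact ⟨p, hp, ⟨k, hk, hpk.symm⟩, rfl⟩
      · rintro ⟨p, hp, ⟨k, hk, hpk⟩, rfl⟩
        exact ⟨k, hk, p, hp, hpk.symm, rfl⟩
    refine ⟨splice D i arcs (occurrences S P B) (h.admissible S), ?_, ?_⟩
    · obtain ⟨f, hf, hf'⟩ := exists_exchange (S := gadgetTriangles S P B)
        (fun d hd e he => gadgetTriangles_disjoint hd he) (fun d ⟨p, hp, _, hd⟩ => by
          subst hd
          simp [Arrow.head, Gadget.first, Gadget.second])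
      rw [hU]
      refine ⟨f, hf, hf', fun j => ?_⟩
      have hD : ∀ j, (D.word j).map f = D.word j := fun j => map_eq_self fun e he =>
        hf' e fun d ⟨p, hp, _, hd⟩ => by
          subst hd
          have h1 := h.fresh j e he
          have h2 := List.le_snd_of_mem_zipIdx hp
          constructor <;> intro hc <;> have hc := congrArg Endpoint.chord hc <;>
            simp only [Arrow.head, Gadget.first, Gadget.second] at hc <;> omega
      by_cases hj : j = i
      · subst hj
        simp only [splice_word, Function.update_self, List.map_append, hD,
          map_realize_occurrences arcs h.left_ne_right hf hf']
      · simp only [splice_word, Function.update_of_ne hj, hD]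
    · refine splice_link_of_value_eq_one _ ?_
      rw [arrowValue_occurrences]
      obtain ⟨k, hk⟩ := hT
      exact htriv S ⟨k, k.2, k, hk, rfl⟩

end Gadget

end VirtualLinks

namespace VirtualLinks

/-! ### Iterated commutators with prescribed values among five permutations. -/

section Commutators

/-- Five permutations each of which is a commutator of two others, and which are conjugated
cyclically into each other by permutations of the same family. -/
def color : Fin 5 → Equiv.Perm (Fin 5) :=
  ![⟨![1, 2, 3, 4, 0], ![4, 0, 1, 2, 3], by decide, by decide⟩,
    ⟨![2, 4, 1, 0, 3], ![3, 2, 0, 4, 1], by decide, by decide⟩,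
    ⟨![1, 3, 0, 4, 2], ![2, 0, 4, 1, 3], by decide, by decide⟩,
    ⟨![2, 4, 3, 1, 0], ![4, 3, 0, 2, 1], by decide, by decide⟩,
    ⟨![4, 3, 1, 0, 2], ![3, 2, 4, 1, 0], by decide, by decide⟩]

/-- The first entry of a commutator that represents a colour. -/
def leftPart : Fin 5 → Fin 5 := ![4, 0, 1, 2, 3]

/-- The second entry of a commutator that represents a colour. -/
def rightPart : Fin 5 → Fin 5 := ![2, 3, 0, 0, 2]

/-- The colour that conjugates a colour to the next one. -/
def conjugator : Fin 5 → Fin 5 := ![3, 4, 0, 1, 2]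

/-- Used recursively to write each colour as an iterated commutator of arbitrary depth. -/
theorem color_commutator (k : Fin 5) : color (leftPart k) * color (rightPart k) *
    (color (leftPart k))⁻¹ * (color (rightPart k))⁻¹ = color k := by
  revert k
  decide

/-- The addition is cyclic: five conjugations return to the first colour. -/
theorem color_conj (k : Fin 5) :
    (color (conjugator k))⁻¹ * color k * color (conjugator k) = color (k + 1) := by
  revert k
  decide

theorem color_left_ne_right (k : Fin 5) : color (leftPart k) ≠ color (rightPart k) := by
  revert k
  decide

/-- The commutator of two lists of gadgets. -/
def gadgetCommutator {α : Type*} (X Y : List (Gadget α)) : List (Gadget α) :=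
  X ++ Y ++ (X.map Gadget.inv).reverse ++ (Y.map Gadget.inv).reverse

theorem mem_gadgetCommutator {α : Type*} {X Y : List (Gadget α)} {γ : Gadget α} :
    γ ∈ gadgetCommutator X Y ↔ (γ ∈ X ∨ γ ∈ Y) ∨ ∃ δ, (δ ∈ X ∨ δ ∈ Y) ∧ δ.inv = γ := by
  simp only [gadgetCommutator, List.mem_append, List.mem_reverse, List.mem_map, or_and_right,
    exists_or, or_assoc]

/-- The inverse of [x, y] is [y, x], so inverses are again gadgets with a triangle of the same
index. This keeps iterated commutators within lists of gadgets. -/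
theorem value_inv {α H : Type*} [Group H] (T : Set ℕ) (φ : α × α → H) (γ : Gadget α) :
    γ.inv.value T φ = (γ.value T φ)⁻¹ := by
  unfold Gadget.value Gadget.inv
  split_ifs
  · simp
  · group

theorem prod_reverse_inv {α H : Type*} [Group H] (T : Set ℕ) (φ : α × α → H)
    (X : List (Gadget α)) :
    ((X.map Gadget.inv).reverse.map (Gadget.value T φ)).prod =
      (X.map (Gadget.value T φ)).prod⁻¹ := by
  rw [List.prod_inv_reverse, List.map_reverse, List.map_map, List.map_map]
  congr 2
  exact List.map_congr_left fun γ _ => value_inv T φ γ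

theorem prod_gadgetCommutator {α H : Type*} [Group H] (T : Set ℕ) (φ : α × α → H)
    (X Y : List (Gadget α)) :
    ((gadgetCommutator X Y).map (Gadget.value T φ)).prod =
      (X.map (Gadget.value T φ)).prod * (Y.map (Gadget.value T φ)).prod *
      (X.map (Gadget.value T φ)).prod⁻¹ * (Y.map (Gadget.value T φ)).prod⁻¹ := by
  simp only [gadgetCommutator, List.map_append, List.prod_append, prod_reverse_inv]

/-- The iterated commutator with gadgets of indices `0, …, m` that has the value `color k`, in the
block `j` of the `t`-th copy. -/
def gadgetWord (t : ℕ) (j : Fin 5) : ℕ → Fin 5 → List (Gadget (ℕ × Fin 5))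
  | 0, k => [⟨(t, j), 0, (t, leftPart k), (t, rightPart k)⟩]
  | m + 1, k => gadgetCommutator
      [⟨(t, j), m + 1, (t, leftPart (leftPart k)), (t, rightPart (leftPart k))⟩]
      (gadgetWord t j m (rightPart k))

theorem gadgetWord_mem {t : ℕ} {j : Fin 5} {m : ℕ} {k : Fin 5} {γ : Gadget (ℕ × Fin 5)}
    (h : γ ∈ gadgetWord t j m k) :
    γ.block = (t, j) ∧ γ.left.1 = t ∧ γ.right.1 = t ∧ color γ.left.2 ≠ color γ.right.2 := by
  induction m generalizing k γ with
  | zero =>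
    obtain rfl := List.mem_singleton.1 h
    simp [color_left_ne_right]
  | succ m ih =>
    have key : ∀ δ : Gadget (ℕ × Fin 5), (δ ∈ [(⟨(t, j), m + 1, (t, leftPart (leftPart k)),
        (t, rightPart (leftPart k))⟩ : Gadget (ℕ × Fin 5))] ∨
        δ ∈ gadgetWord t j m (rightPart k)) →
        δ.block = (t, j) ∧ δ.left.1 = t ∧ δ.right.1 = t ∧ color δ.left.2 ≠ color δ.right.2 := by
      rintro δ (hδ | hδ)
      · obtain rfl := List.mem_singleton.1 hδ
        simp [color_left_ne_right]
      · exact ih hδ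
    rw [gadgetWord, mem_gadgetCommutator] at h
    rcases h with h | ⟨δ, h, rfl⟩
    · exact key γ h
    · obtain ⟨h1, h2, h3, h4⟩ := key δ h
      exact ⟨h1, h3, h2, h4.symm⟩

theorem gadgetWord_index (t : ℕ) (j : Fin 5) {m i : ℕ} (hi : i ≤ m) (k : Fin 5) :
    ∃ γ ∈ gadgetWord t j m k, γ.index = i := by
  induction m generalizing k with
  | zero => exact ⟨_, List.mem_singleton_self _, (Nat.le_zero.1 hi).symm⟩
  | succ m ih =>
    rcases hi.eq_or_lt with rfl | hi
    · exact ⟨_, mem_gadgetCommutator.2 (Or.inl (Or.inl (List.mem_singleton_self _))), rfl⟩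
    · obtain ⟨γ, hγ, h⟩ := ih (Nat.lt_succ_iff.1 hi) (rightPart k)
      exact ⟨γ, mem_gadgetCommutator.2 (Or.inl (Or.inr hγ)), h⟩

/-- A commutator with a trivial entry is trivial, and every index up to `m` occurs as an entry at
some level. -/
theorem gadgetWord_value_eq_one {H : Type*} [Group H] (T : Set ℕ)
    (φ : (ℕ × Fin 5) × (ℕ × Fin 5) → H) (t : ℕ) (j : Fin 5) {m : ℕ} (h : ∃ i ≤ m, i ∈ T)
    (k : Fin 5) : ((gadgetWord t j m k).map (Gadget.value T φ)).prod = 1 := by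
  obtain ⟨i, hi, hT⟩ := h
  induction m generalizing k with
  | zero =>
    obtain rfl := Nat.le_zero.1 hi
    simp [gadgetWord, Gadget.value, hT]
  | succ m ih =>
    rw [gadgetWord, prod_gadgetCommutator]
    rcases hi.eq_or_lt with rfl | hi
    · simp [Gadget.value, hT]
    · rw [ih (rightPart k) (Nat.lt_succ_iff.1 hi)]
      simp

theorem gadgetWord_value_of_block {H : Type*} [Group H] {φ : (ℕ × Fin 5) × (ℕ × Fin 5) → H}
    {t : ℕ} {j : Fin 5} (h : ∀ x, φ ((t, j), x) = 1) (m : ℕ) (k : Fin 5) :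
    ((gadgetWord t j m k).map (Gadget.value ∅ φ)).prod = 1 := by
  refine List.prod_eq_one fun x hx => ?_
  obtain ⟨γ, hγ, rfl⟩ := List.mem_map.1 hx
  simp [Gadget.value, (gadgetWord_mem hγ).1, h]

/-- The outer gadget evaluates to `color (leftPart k)`, the inner word by induction to `color
(rightPart k)`; their commutator is `color k`. -/
theorem gadgetWord_value {φ : (ℕ × Fin 5) × (ℕ × Fin 5) → Equiv.Perm (Fin 5)} {t : ℕ} {j : Fin 5}
    (h : ∀ x, φ ((t, j), (t, x)) = color x) (m : ℕ) (k : Fin 5) :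
    ((gadgetWord t j m k).map (Gadget.value ∅ φ)).prod = color k := by
  induction m generalizing k with
  | zero => simp [gadgetWord, Gadget.value, h, color_commutator]
  | succ m ih =>
    rw [gadgetWord, prod_gadgetCommutator, ih]
    simp [Gadget.value, h, color_commutator]

theorem prod_map_flatMap {X Y H : Type*} [Monoid H] (l : List X) (f : X → List Y) (g : Y → H) :
    ((l.flatMap f).map g).prod = (l.map fun a => ((f a).map g).prod).prod := by
  induction l with
  | nil => simp
  | cons a l ih => simp [ih]

/-- The gadgets of the `t`-th copy of the knot. -/
def copyGadgets (m t : ℕ) : List (Gadget (ℕ × Fin 5)) :=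
  (List.finRange 5).flatMap fun j => gadgetWord t j m (conjugator j)

/-- The arcs of the `t`-th copy of the knot. -/
def copyArcs (t : ℕ) : List (ℕ × Fin 5) := (List.finRange 5).map fun j => (t, j)

/-- The gadgets of the connected sum of `l` copies of the knot. -/
def sumGadgets (m l : ℕ) : List (Gadget (ℕ × Fin 5)) := (List.range l).flatMap (copyGadgets m)

/-- The arcs of the connected sum of `l` copies of the knot. -/
def sumArcs (l : ℕ) : List (ℕ × Fin 5) := (List.range l).flatMap copyArcs

theorem mem_copyArcs {t : ℕ} {x : ℕ × Fin 5} : x ∈ copyArcs t ↔ x.1 = t := by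
  simp only [copyArcs, List.mem_map, List.mem_finRange, true_and]
  exact ⟨fun ⟨j, h⟩ => h ▸ rfl, fun h => ⟨x.2, Prod.ext h.symm rfl⟩⟩

theorem mem_sumArcs {l : ℕ} {x : ℕ × Fin 5} : x ∈ sumArcs l ↔ x.1 < l := by
  simp [sumArcs, mem_copyArcs]

theorem mem_copyGadgets {m t : ℕ} {γ : Gadget (ℕ × Fin 5)} (h : γ ∈ copyGadgets m t) :
    γ.block.1 = t ∧ γ.left.1 = t ∧ γ.right.1 = t ∧ color γ.left.2 ≠ color γ.right.2 := by
  obtain ⟨j, -, h⟩ := List.mem_flatMap.1 h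
  obtain ⟨h1, h2⟩ := gadgetWord_mem h
  exact ⟨by rw [h1], h2⟩

theorem mem_sumGadgets {m l : ℕ} {γ : Gadget (ℕ × Fin 5)} (h : γ ∈ sumGadgets m l) :
    γ.block.1 < l ∧ γ.left.1 < l ∧ γ.right.1 < l ∧ γ.left ≠ γ.right := by
  obtain ⟨t, ht, h⟩ := List.mem_flatMap.1 h
  have ht := List.mem_range.1 ht
  obtain ⟨h1, h2, h3, h4⟩ := mem_copyGadgets h
  exact ⟨by omega, by omega, by omega, fun h => h4 (by rw [h])⟩

theorem sumArcs_nodup (l : ℕ) : (sumArcs l).Nodup := by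
  rw [sumArcs, List.nodup_flatMap]
  refine ⟨fun t _ => (List.nodup_finRange 5).map fun _ _ h => (Prod.ext_iff.1 h).2,
    List.nodup_range.pairwise_of_forall_ne fun t _ t' _ hne x h1 h2 => ?_⟩
  exact hne ((mem_copyArcs.1 h1).symm.trans (mem_copyArcs.1 h2))

theorem gadgetsFit_sum {μ : ℕ} {D : GaussDiagram μ} {B : ℕ}
    (h : ∀ i, ∀ e ∈ D.word i, e.chord < 4 * B) (m l : ℕ) :
    GadgetsFit D (sumArcs l) (sumGadgets m l) B where
  arcs_nodup := sumArcs_nodup l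
  block_mem _ hγ := mem_sumArcs.2 (mem_sumGadgets hγ).1
  left_mem _ hγ := mem_sumArcs.2 (mem_sumGadgets hγ).2.1
  right_mem _ hγ := mem_sumArcs.2 (mem_sumGadgets hγ).2.2.1
  left_ne_right _ hγ := (mem_sumGadgets hγ).2.2.2
  fresh := h

theorem fSimilar_sum {μ : ℕ} {D : GaussDiagram μ} (i : Fin μ) {B : ℕ}
    (h : ∀ i, ∀ e ∈ D.word i, e.chord < 4 * B) {m l : ℕ} (hl : 0 < l) :
    FSimilar (m + 1) (splice D i (sumArcs l) (occurrences ∅ (sumGadgets m l) B)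
      ((gadgetsFit_sum h m l).admissible ∅)).link D.link := by
  refine fSimilar_splice i (gadgetsFit_sum h m l) (fun k hk => ?_) fun T hT => ?_
  -- The copy with number 0 exists because `l` is positive, and its first block already contains
  -- every index.
  · obtain ⟨γ, hγ, hi⟩ := gadgetWord_index 0 0 (Nat.lt_succ_iff.1 hk) (conjugator 0)
    exact ⟨γ, List.mem_flatMap.2 ⟨0, List.mem_range.2 hl,
      List.mem_flatMap.2 ⟨0, List.mem_finRange 0, hγ⟩⟩, hi⟩
  · have hT' : ∃ k ≤ m, k ∈ T := hT.imp fun k hk => ⟨Nat.lt_succ_iff.1 hk.1, hk.2⟩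
    simp only [sumGadgets, copyGadgets, prod_map_flatMap]
    refine List.prod_eq_one fun x hx => ?_
    obtain ⟨t, -, rfl⟩ := List.mem_map.1 hx
    refine List.prod_eq_one fun x hx => ?_
    obtain ⟨j, -, rfl⟩ := List.mem_map.1 hx
    exact gadgetWord_value_eq_one T _ t j hT' _

end Commutators

/-! ### Splicing in new chords with a nonconstant colouring increases the count. -/

section Growth

variable {G : Type*} [Group G] {μ : ℕ}

theorem finite_occurs (w : Fin μ → List Endpoint) : {a | Occurs w a}.Finite := by
  have : {a | Occurs w a} = ⋃ i, Endpoint.chord '' {e | e ∈ w i} := by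
    ext a
    simp [Occurs]
  rw [this]
  exact Set.finite_iUnion fun i => (List.finite_toSet (w i)).image _

theorem finite_coloring [Finite G] (w : Fin μ → List Endpoint) : Finite (Coloring G w) := by
  have : Finite {a | Occurs w a} := finite_occurs w
  refine Finite.of_injective (β := ({a | Occurs w a} → G) × (Fin μ → G))
    (fun p => (fun a => p.1.1 a, p.1.2)) ?_
  rintro ⟨⟨c, b⟩, hc, _⟩ ⟨⟨c', b'⟩, hc', _⟩ h
  simp only [Prod.mk.injEq] at h
  refine Subtype.ext (Prod.ext (funext fun a => ?_) h.2)
  by_cases ha : Occurs w a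
  · exact congrFun h.1 ⟨a, ha⟩
  · exact (hc a ha).trans (hc' a ha).symm

theorem chain_const {c : ℕ → G} {g : G} {l : List Endpoint} (h : ∀ e ∈ l, c e.chord = g) :
    Chain (crossing c) g l g := by
  induction l with
  | nil => rfl
  | cons e l ih =>
    refine ⟨g, ?_, ih fun e he => h e (by simp [he])⟩
    have := h e (by simp)
    unfold crossing
    split_ifs
    · exact ⟨this, rfl⟩
    · rw [this]
      group

/-- Every colouring of `w` extends by giving all chords of `r` the base point colour of the circle
`i`. The colouring `c` of `r`, joined to the constant colouring `x` of `w`, is not of this kind. -/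
theorem coloring_card_lt [Finite G] (w : Fin μ → List Endpoint) (i : Fin μ) (r : List Endpoint)
    (hr : ∀ e ∈ r, ¬ Occurs w e.chord) {c : ℕ → G} {x : G} (hc : Chain (crossing c) x r x)
    (hne : ∃ e ∈ r, c e.chord ≠ x) :
    Nat.card (Coloring G w) < Nat.card (Coloring G (Function.update w i (w i ++ r))) := by
  classical
  have := finite_coloring (G := G) w
  have := finite_coloring (G := G) (Function.update w i (w i ++ r))
  have hocc : ∀ a, Occurs (Function.update w i (w i ++ r)) a ↔
      Occurs w a ∨ ∃ e ∈ r, e.chord = a := by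
    intro a
    constructor
    · rintro ⟨j, e, he, rfl⟩
      by_cases hj : j = i
      · subst hj
        rw [Function.update_self, List.mem_append] at he
        exact he.imp (fun he => ⟨j, e, he, rfl⟩) fun he => ⟨e, he, rfl⟩
      · rw [Function.update_of_ne hj] at he
        exact Or.inl ⟨j, e, he, rfl⟩
    · rintro (⟨j, e, he, rfl⟩ | ⟨e, he, rfl⟩)
      · refine ⟨j, e, ?_, rfl⟩
        by_cases hj : j = i
        · subst hj
          simp [he]
        · simpa [hj] using he
      · exact ⟨i, e, by simp [he], rfl⟩
  have hchain : ∀ (c : ℕ → G) (b : Fin μ → G), (∀ j, Chain (crossing c) (b j) (w j) (b j)) →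
      Chain (crossing c) (b i) r (b i) →
      ∀ j, Chain (crossing c) (b j) (Function.update w i (w i ++ r) j) (b j) := by
    intro c b h1 h2 j
    by_cases hj : j = i
    · subst hj
      rw [Function.update_self, chain_append]
      exact ⟨_, h1 j, h2⟩
    · rw [Function.update_of_ne hj]
      exact h1 j
  let ext : (ℕ → G) → (ℕ → G) → ℕ → G := fun c c' a => if ∃ e ∈ r, e.chord = a then c' a else c a
  have hext_r : ∀ c c' : ℕ → G, ∀ e ∈ r, ext c c' e.chord = c' e.chord := fun c c' e he =>
    if_pos ⟨e, he, rfl⟩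
  have hext_w : ∀ c c' : ℕ → G, ∀ a, Occurs w a → ext c c' a = c a := fun c c' a ha =>
    if_neg fun ⟨e, he, hea⟩ => hr e he (hea ▸ ha)
  have hext_off : ∀ c c' : ℕ → G, (∀ a, ¬ Occurs w a → c a = 1) →
      ∀ a, ¬ Occurs (Function.update w i (w i ++ r)) a → ext c c' a = 1 := by
    intro c c' hc a ha
    rw [hocc, not_or] at ha
    exact (if_neg ha.2).trans (hc a ha.1)
  have hext_chain : ∀ c c' : ℕ → G, ∀ j g h, Chain (crossing (ext c c')) g (w j) h ↔
      Chain (crossing c) g (w j) h := fun c c' j g h =>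
    chain_congr (fun e he => crossing_congr (hext_w c c' _ ⟨j, e, he, rfl⟩)) g h
  let F : Coloring G w → Coloring G (Function.update w i (w i ++ r)) := fun p =>
    ⟨(ext p.1.1 fun _ => p.1.2 i, p.1.2), hext_off _ _ p.2.1, hchain _ _
      (fun j => (hext_chain _ _ _ _ _).2 (p.2.2 j))
      (chain_const fun e he => hext_r p.1.1 (fun _ => p.1.2 i) e he)⟩
  have hF : Function.Injective F := by
    rintro ⟨⟨c, b⟩, hc, _⟩ ⟨⟨c', b'⟩, hc', _⟩ h
    have h := congrArg Subtype.val h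
    obtain rfl : b = b' := congrArg Prod.snd h
    refine Subtype.ext (Prod.ext (funext fun a => ?_) rfl)
    by_cases ha : Occurs w a
    · have := congrFun (congrArg Prod.fst h) a
      simpa only [F, hext_w _ _ a ha] using this
    · exact (hc a ha).trans (hc' a ha).symm
  -- Constant on the chords of `w` and normalised to 1 elsewhere.
  let c₀ : ℕ → G := fun a => if Occurs w a then x else 1
  let q : Coloring G (Function.update w i (w i ++ r)) :=
    ⟨(ext c₀ c, fun _ => x), hext_off _ _ fun a ha => if_neg ha, hchain _ _
      (fun j => (hext_chain _ _ _ _ _).2 (chain_const fun e he => if_pos ⟨j, e, he, rfl⟩))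
      ((chain_congr (fun e he => crossing_congr (hext_r _ _ e he)) _ _).2 hc)⟩
  -- A preimage would have base point colour `x`, hence colour `x` on every chord of `r`.
  have hq : q ∉ Set.range F := by
    rintro ⟨p, hp⟩
    have hp := congrArg Subtype.val hp
    have hb : p.1.2 = fun _ => x := congrArg Prod.snd hp
    obtain ⟨e, he, hex⟩ := hne
    have := congrFun (congrArg Prod.fst hp) e.chord
    simp only [F, q, hext_r _ _ e he, hb] at this
    exact hex this.symm
  rw [← Nat.card_range_of_injective hF, Nat.card_coe_set_eq]
  exact Set.ncard_lt_card fun h => hq (h ▸ Set.mem_univ q)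

end Growth

/-! ### Colourings of the copies and strict growth of their number. -/

section Copies

theorem realize_append_left {α : Type*} [DecidableEq α] {arcs : List α}
    {occ occ' : List (Arrow α)} (h : ∀ o ∈ occ', o.block ∉ arcs ∧ o.letter ∉ arcs) :
    realize arcs (occ ++ occ') = realize arcs occ := by
  refine List.flatMap_congr fun k hk => ?_
  have h1 : occ'.filter (fun o => o.letter = k) = [] := List.filter_eq_nil_iff.2 fun o ho => by
    simpa using fun hko : o.letter = k => (h o ho).2 (hko ▸ hk)
  have h2 : occ'.filter (fun o => o.block = k) = [] := List.filter_eq_nil_iff.2 fun o ho => by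
    simpa using fun hko : o.block = k => (h o ho).1 (hko ▸ hk)
  rw [List.filter_append, List.filter_append, h1, h2, List.append_nil, List.append_nil]

theorem realize_append_right {α : Type*} [DecidableEq α] {arcs : List α}
    {occ occ' : List (Arrow α)} (h : ∀ o ∈ occ, o.block ∉ arcs ∧ o.letter ∉ arcs) :
    realize arcs (occ ++ occ') = realize arcs occ' := by
  refine List.flatMap_congr fun k hk => ?_
  have h1 : occ.filter (fun o => o.letter = k) = [] := List.filter_eq_nil_iff.2 fun o ho => by
    simpa using fun hko : o.letter = k => (h o ho).2 (hko ▸ hk)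
  have h2 : occ.filter (fun o => o.block = k) = [] := List.filter_eq_nil_iff.2 fun o ho => by
    simpa using fun hko : o.block = k => (h o ho).1 (hko ▸ hk)
  rw [List.filter_append, List.filter_append, h1, h2, List.nil_append, List.nil_append]

theorem occurrences_arcs {α : Type*} {P : List (Gadget α)} {B : ℕ} {o : Arrow α}
    (ho : o ∈ occurrences ∅ P B) :
    ∃ γ ∈ P, o.block = γ.block ∧ (o.letter = γ.left ∨ o.letter = γ.right) := by
  obtain ⟨p, hp, ho⟩ := mem_occurrences.1 ho
  refine ⟨p.1, List.fst_mem_of_mem_zipIdx hp, ?_⟩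
  simp only [Gadget.first, Gadget.second, Gadget.rest, List.mem_cons, List.not_mem_nil,
    or_false] at ho
  rcases ho with rfl | rfl | rfl | rfl <;> simp

/-- An arrow has its block and its letter in the same copy, so different copies occupy separate
stretches of the circle. -/
theorem realize_sum_succ (m l B : ℕ) :
    realize (sumArcs (l + 1)) (occurrences ∅ (sumGadgets m (l + 1)) B) =
      realize (sumArcs l) (occurrences ∅ (sumGadgets m l) B) ++
      realize (copyArcs l) (occurrences ∅ (copyGadgets m l) (B + (sumGadgets m l).length)) := by
  have h1 : sumArcs (l + 1) = sumArcs l ++ copyArcs l := by simp [sumArcs, List.range_succ]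
  have h2 : sumGadgets m (l + 1) = sumGadgets m l ++ copyGadgets m l := by
    simp [sumGadgets, List.range_succ]
  rw [h1, h2, realize_append_arcs, occurrences_append, realize_append_left, realize_append_right]
  · intro o ho
    obtain ⟨γ, hγ, hb, hl⟩ := occurrences_arcs ho
    obtain ⟨g1, g2, g3, -⟩ := mem_sumGadgets hγ
    rw [mem_copyArcs, mem_copyArcs, hb]
    rcases hl with hl | hl <;> rw [hl] <;> omega
  · intro o ho
    obtain ⟨γ, hγ, hb, hl⟩ := occurrences_arcs ho
    obtain ⟨g1, g2, g3, -⟩ := mem_copyGadgets hγ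
    rw [mem_sumArcs, mem_sumArcs, hb]
    rcases hl with hl | hl <;> rw [hl] <;> omega

theorem chain_tails {α G : Type*} [Group G] {c : ℕ → G} {g : G} {occ : List (Arrow α)}
    (h : ∀ o ∈ occ, c o.label = g) : Chain (crossing c) g (occ.map Arrow.tail) g :=
  chain_const fun e he => by
    obtain ⟨o, ho, rfl⟩ := List.mem_map.1 he
    exact h o ho

/-- Successive heads of the block `k` conjugate by the ordered product of their values. Since `φ` is
trivial on the other blocks, this product may be taken over the whole list. -/
theorem chain_heads {α G : Type*} [Group G] [DecidableEq α] {c : ℕ → G}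
    {φ : α × α → G} {k : α} (occ : List (Arrow α)) (hc : ∀ o ∈ occ, o.block = k →
      c o.label = φ (k, o.letter)) (hφ : ∀ j, j ≠ k → ∀ x, φ (j, x) = 1) (g : G) :
    Chain (crossing c) g ((occ.filter fun o => o.block = k).map Arrow.head)
      ((arrowValue φ occ)⁻¹ * g * arrowValue φ occ) := by
  induction occ generalizing g with
  | nil => simp [arrowValue]
  | cons o occ ih =>
    have ih := ih fun o ho => hc o (by simp [ho])
    have hv : arrowValue φ (o :: occ) =
        cond o.pos (φ (o.block, o.letter)) (φ (o.block, o.letter))⁻¹ * arrowValue φ occ := by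
      simp [arrowValue]
    by_cases hk : o.block = k
    · rw [List.filter_cons_of_pos (by simpa using hk), List.map_cons, chain_cons, hv, hk]
      refine ⟨_, (crossing_under _ _ _ _ _).2 rfl, ?_⟩
      rw [hc o (by simp) hk]
      have h1 : φ (k, o.letter) ^ (unitOf o.pos : ℤ) =
          cond o.pos (φ (k, o.letter)) (φ (k, o.letter))⁻¹ := by
        cases o.pos <;> simp [unitOf]
      rw [h1]
      convert ih _ using 1
      group
    · rw [List.filter_cons_of_neg (by simpa using hk), hv, hφ _ hk]
      simpa using ih g

theorem exists_label_function {α X : Type*} [Inhabited X] (occ : List (Arrow α))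
    (h : (occ.map Arrow.label).Nodup) (f : α → X) :
    ∃ c : ℕ → X, ∀ o ∈ occ, c o.label = f o.letter := by
  classical
  refine ⟨fun a => if h : ∃ o ∈ occ, o.label = a then f h.choose.letter else default,
    fun o ho => ?_⟩
  have h' : ∃ o' ∈ occ, o'.label = o.label := ⟨o, ho, rfl⟩
  simp only [dif_pos h']
  rw [List.inj_on_of_nodup_map h h'.choose_spec.1 ho h'.choose_spec.2]

theorem arrowValue_copy {φ : (ℕ × Fin 5) × (ℕ × Fin 5) → Equiv.Perm (Fin 5)} {t : ℕ}
    {j : Fin 5} (h : ∀ x, φ ((t, j), (t, x)) = color x)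
    (h1 : ∀ k, k ≠ (t, j) → ∀ x, φ (k, x) = 1) (m B : ℕ) :
    arrowValue φ (occurrences ∅ (copyGadgets m t) B) = color (conjugator j) := by
  rw [arrowValue_occurrences, copyGadgets, prod_map_flatMap]
  have : ∀ k, ((gadgetWord t k m (conjugator k)).map (Gadget.value ∅ φ)).prod =
      if k = j then color (conjugator j) else 1 := by
    intro k
    split_ifs with hk
    · subst hk
      exact gadgetWord_value h m _
    · exact gadgetWord_value_of_block (h1 _ fun he => hk (Prod.ext_iff.1 he).2) m _
  simp only [this]
  have hr : List.finRange 5 = [0, 1, 2, 3, 4] := rfl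
  rw [hr]
  fin_cases j <;> simp

/-- On arc `j` the tails demand `color j`, and the block of heads conjugates by `color (conjugator
j)`, which gives the colour that the next arc demands. -/
theorem chain_copy (m t B : ℕ) : ∃ c : ℕ → Equiv.Perm (Fin 5),
    (∀ o ∈ occurrences ∅ (copyGadgets m t) B, c o.label = color o.letter.2) ∧
    Chain (crossing c) (color 0) (realize (copyArcs t) (occurrences ∅ (copyGadgets m t) B))
      (color 0) := by
  obtain ⟨c, hc⟩ := exists_label_function (occurrences ∅ (copyGadgets m t) B)
    (by rw [occurrences_labels]; exact List.nodup_range')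
    (fun x : ℕ × Fin 5 => color x.2)
  refine ⟨c, hc, ?_⟩
  have step : ∀ j : Fin 5, Chain (crossing c) (color j)
      (realize [(t, j)] (occurrences ∅ (copyGadgets m t) B)) (color (j + 1)) := by
    intro j
    simp only [realize, List.flatMap_cons, List.flatMap_nil, List.append_nil, chain_append]
    refine ⟨color j, chain_tails fun o ho => ?_, ?_⟩
    · simp only [List.mem_filter, decide_eq_true_eq] at ho
      rw [hc o ho.1, ho.2]
    -- The assignment reads the colour of a letter in the block of arc `j` and is 1 in all other
    -- blocks, so only the gadget word of this arc contributes.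
    · have hv := arrowValue_copy (t := t) (j := j)
        (φ := fun p => if p.1 = (t, j) then color p.2.2 else 1) (by simp)
        (fun k hk x => by simp [hk]) m B
      rw [← color_conj, ← hv]
      exact chain_heads _ (fun o ho _ => by simp [hc o ho]) (fun k hk x => by simp [hk]) _
  have harcs : copyArcs t = [(t, 0)] ++ [(t, 1)] ++ [(t, 2)] ++ [(t, 3)] ++ [(t, 4)] := rfl
  simp only [harcs, realize_append_arcs, chain_append]
  -- The last step ends at `color (4 + 1)`, which is `color 0` in `Fin 5`.
  exact ⟨color 4, ⟨color 3, ⟨color 2, ⟨color 1, step 0, step 1⟩, step 2⟩, step 3⟩, step 4⟩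

/-- The two letters of a gadget have different colours, so at least one differs from `color 0`. This
makes the colouring of a copy nonconstant. -/
theorem exists_letter_color_ne (m t B : ℕ) : ∃ o ∈ occurrences ∅ (copyGadgets m t) B,
    color o.letter.2 ≠ color 0 ∧ o.letter ∈ copyArcs t := by
  obtain ⟨γ, hγ, -⟩ := gadgetWord_index t 0 (Nat.zero_le m) (conjugator 0)
  have hmem : γ ∈ copyGadgets m t := List.mem_flatMap.2 ⟨0, List.mem_finRange 0, hγ⟩
  obtain ⟨-, hl, hr, hne⟩ := mem_copyGadgets hmem
  obtain ⟨q, hq, rfl⟩ := List.mem_iff_getElem.1 hmem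
  have hp : ((copyGadgets m t)[q], B + q) ∈ (copyGadgets m t).zipIdx B :=
    List.mk_add_mem_zipIdx_iff_getElem?.2 (List.getElem?_eq_getElem hq)
  by_cases h0 : color (copyGadgets m t)[q].left.2 = color 0
  · exact ⟨_, mem_occurrences.2 ⟨_, hp, Or.inr (Or.inl rfl)⟩, fun h => hne (h0.trans h.symm),
      mem_copyArcs.2 hr⟩
  · exact ⟨_, mem_occurrences.2 ⟨_, hp, Or.inl rfl⟩, h0, mem_copyArcs.2 hl⟩

theorem coloringNumber_strictMono {μ : ℕ} {D : GaussDiagram μ} (i : Fin μ) {B : ℕ}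
    (h : ∀ i, ∀ e ∈ D.word i, e.chord < 4 * B) (m : ℕ) :
    StrictMono fun l => coloringNumber (Equiv.Perm (Fin 5)) (splice D i (sumArcs l)
      (occurrences ∅ (sumGadgets m l) B) ((gadgetsFit_sum h m l).admissible ∅)).link := by
  refine strictMono_nat_of_lt_succ fun l => ?_
  set w := (splice D i (sumArcs l) (occurrences ∅ (sumGadgets m l) B)
    ((gadgetsFit_sum h m l).admissible ∅)).word with hw
  set r := realize (copyArcs l) (occurrences ∅ (copyGadgets m l) (B + (sumGadgets m l).length))
    with hr
  have hword : (splice D i (sumArcs (l + 1)) (occurrences ∅ (sumGadgets m (l + 1)) B)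
      ((gadgetsFit_sum h m (l + 1)).admissible ∅)).word = Function.update w i (w i ++ r) := by
    rw [hw, splice_word, splice_word, realize_sum_succ, Function.update_idem,
      Function.update_self, List.append_assoc]
  change Nat.card (Coloring _ w) < Nat.card (Coloring _ (GaussDiagram.word _))
  rw [hword]
  obtain ⟨c, hc, hchain⟩ := chain_copy m l (B + (sumGadgets m l).length)
  refine coloring_card_lt w i r ?_ hchain ?_
  -- Labels grow from left to right: those of the diagram lie below `4 * B`, those of the earlier
  -- copies come next, and those of the new copy are larger still.
  · rintro e he ⟨j, e', he', hch⟩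
    obtain ⟨o, ho, hoe⟩ := mem_realize.1 he
    have hel : e.chord = o.label := by
      rcases hoe with ⟨-, rfl⟩ | ⟨-, rfl⟩ <;> rfl
    have h1 : o.label ∈ (occurrences ∅ (copyGadgets m l) (B + (sumGadgets m l).length)).map
      Arrow.label := List.mem_map_of_mem ho
    rw [occurrences_labels, List.mem_range'_1] at h1
    have h2 : e'.chord < 4 * (B + (sumGadgets m l).length) := by
      have hsplit : e' ∈ D.word j ∨
          e' ∈ realize (sumArcs l) (occurrences ∅ (sumGadgets m l) B) := by
        rw [hw, splice_word] at he'
        by_cases hj : j = i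
        · subst hj
          simpa using he'
        · exact Or.inl (by simpa [hj] using he')
      rcases hsplit with he' | he'
      · have := h j e' he'
        omega
      · obtain ⟨o', ho', hoe'⟩ := mem_realize.1 he'
        have hel' : e'.chord = o'.label := by
          rcases hoe' with ⟨-, rfl⟩ | ⟨-, rfl⟩ <;> rfl
        have h3 : o'.label ∈ (occurrences ∅ (sumGadgets m l) B).map Arrow.label :=
          List.mem_map_of_mem ho'
        rw [occurrences_labels, List.mem_range'_1] at h3
        omega
    omega
  · obtain ⟨o, ho, hne, hmem⟩ :=
      exists_letter_color_ne m l (B + (sumGadgets m l).length)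
    refine ⟨o.tail, mem_realize.2 ⟨o, ho, Or.inl ⟨hmem, rfl⟩⟩, ?_⟩
    change c o.label ≠ _
    rwa [hc o ho]

end Copies

end VirtualLinks

/-! ### The theorem. -/

open VirtualLinks
theorem theorem1 (μ : ℕ) (hμ : 1 ≤ μ) (L : VirtualLinks.VirtualLink μ) (n : ℕ) (hn : 1 ≤ n) :
    ∃ (K : ℕ+ → VirtualLinks.VirtualKnot) (M : ℕ+ → VirtualLinks.VirtualLink μ),
      (∀ ℓ, VirtualLinks.FTrivial n (K ℓ)) ∧
      (∀ ℓ, VirtualLinks.IsConnectedSum L (K ℓ) (M ℓ)) ∧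
      (∀ ℓ, VirtualLinks.FSimilar n (M ℓ) L) ∧
      (∀ ℓ ℓ', ℓ ≠ ℓ' → M ℓ ≠ M ℓ') := by
  obtain ⟨D, rfl⟩ := Quot.exists_rep L
  obtain ⟨m, rfl⟩ := Nat.exists_eq_add_of_le' hn
  obtain ⟨B, hB⟩ : ∃ B, ∀ i, ∀ e ∈ D.word i, e.chord < 4 * B := by
    obtain ⟨B, hB⟩ := (finite_occurs D.word).bddAbove
    refine ⟨B + 1, fun i e he => ?_⟩
    have : e.chord ≤ B := hB ⟨i, e, he, rfl⟩
    omega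
  -- The same `B` serves for the trivial knot, so the word of the knot is literally the word spliced
  -- into `D`, and the connected sum needs no relabelling.
  have hB' : ∀ i, ∀ e ∈ GaussDiagram.trivialKnot.word i, e.chord < 4 * B := fun i e he => by
    cases he
  refine ⟨fun l => (splice GaussDiagram.trivialKnot 0 (sumArcs l)
    (occurrences ∅ (sumGadgets m l) B) ((gadgetsFit_sum hB' m l).admissible ∅)).link,
    fun l => (splice D ⟨0, hμ⟩ (sumArcs l) (occurrences ∅ (sumGadgets m l) B)
    ((gadgetsFit_sum hB m l).admissible ∅)).link, fun l => ?_, fun l => ?_, fun l => ?_,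
    fun l l' hne h => hne ?_⟩
  · exact fSimilar_sum 0 hB' l.pos
  · refine ⟨D, _, _, ⟨0, hμ⟩, rfl, rfl, rfl, ?_, fun j hj => ?_⟩
    · simp [splice_word, GaussDiagram.trivialKnot]
    · simp [splice_word, hj]
  · exact fSimilar_sum _ hB l.pos
  · exact PNat.coe_injective ((coloringNumber_strictMono ⟨0, hμ⟩ hB m).injective
      (congrArg (coloringNumber (Equiv.Perm (Fin 5))) h))
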